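/- For a field $K$ and $a,b\in K$ let $E_{a,b}$ denote the curve $y^2+axy+by=x^3+bx^2$. In each of the following four cases $K=\mathbb{Q}(w)$ is a quadratic field, $E_{a,b}$ is an elliptic curve over $K$, and its Mordell–Weil group $E_{a,b}(K)$ contains a subgroup isomorphic to the indicated group; in cases (1)–(3) the listed points lie on $E_{a,b}$, and the embedding of the group can be chosen so that they are the images of the standard basis of the free part (in particular they are independent points of infinite order). (1) $w^2-w-86=0$, $(a,b)=\left(\frac{10w+493}{448},\frac{10w+45}{448}\right)$: $E_{a,b}(K)$ contains $\mathbb{Z}/15\mathbb{Z}\oplus\mathbb{Z}$, with the point $\left(\frac{-w-274}{3584},\frac{-2455w-20382}{200704}\right)$. (2) $w^2+163w+12=0$, $(a,b)=\left(\frac{25105w+2071}{216},\frac{634768555w+46752805}{7776}\right)$: $E_{a,b}(K)$ contains $\mathbb{Z}/18\mathbb{Z}\oplus\mathbb{Z}^2$, with the points $\left(\frac{3673w+223}{486},\frac{150110959w+11056609}{8748}\right)$ and $\left(\frac{-112579w-8293}{6},\frac{-3011095399w-221775913}{288}\right)$. (3) $w^2=55325286553$, $(a,b)=\left(-\frac{1001929453}{87419475},-\frac{1089348928}{87419475}\right)$: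 $E_{a,b}(K)$ contains $\mathbb{Z}/2\mathbb{Z}\oplus\mathbb{Z}/10\mathbb{Z}\oplus\mathbb{Z}^4$, with the points $\left(-\frac{76249664}{9062625},-\frac{3294239461376}{55961709375}\right)$, $\left(\frac{1378903694270734}{47323818070815},-\frac{233856747339051186962702}{6331823076742017702705}\right)$, $\left(-\frac{317897024}{55559933},-\frac{54763043233792}{3408435209751}\right)$ and $\left(-\frac{10158696384}{631362875},-\frac{66880771114752}{779733150625}\right)$. (4) $w^2=2947271015$, $(a,b)=\left(\frac{1024873209359}{27734204981},-\frac{543206429719981170}{2187369012646489}\right)$: $E_{a,b}(K)$ contains $\mathbb{Z}/2\mathbb{Z}\oplus\mathbb{Z}/12\mathbb{Z}\oplus\mathbb{Z}^4$. In particular, there exist elliptic curves over quadratic fields whose Mordell–Weil groups contain $\mathbb{Z}/15\mathbb{Z}\oplus\mathbb{Z}$, $\mathbb{Z}/18\mathbb{Z}\oplus\mathbb{Z}^2$, $\mathbb{Z}/2\mathbb{Z}\oplus\mathbb{Z}/10\mathbb{Z}\oplus\mathbb{Z}^4$ and $\mathbb{Z}/2\mathbb{Z}\oplus\mathbb{Z}/12\mathbb{Z}\oplus\mathbb{Z}^4$.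 -/

import Mathlib

/-- `K` is a quadratic number field. -/
def IsQuadraticField (K : Type) [Field K] [NumberField K] : Prop :=
  Module.finrank ℚ K = 2

/-- The Weierstrass curve `y² + a x y + b y = x³ + b x²` in Tate form with parameters `(a, b)`. -/
def tateCurve {K : Type} [Field K] (a b : K) : WeierstrassCurve K where
  a₁ := a
  a₂ := b
  a₃ := b
  a₄ := 0
  a₆ := 0

open Classical in
/-- The Mordell–Weil group `E(K)` contains (a copy of) `T ⊕ ℤ^r`. -/
def MordellWeilContains {K : Type} [Field K] (E : WeierstrassCurve K)
    (T : Type) [AddCommGroup T] (r : ℕ) : Prop :=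
  ∃ f : T × (Fin r → ℤ) →+ E.toAffine.Point, Function.Injective f

open Classical in
/-- The Mordell–Weil group `E(K)` contains a copy of `T ⊕ ℤ^r` in which the standard basis of `ℤ^r`
is given by the affine points `(x i, y i)`; in particular these lie on `E`, have infinite order and
are independent. -/
def MordellWeilContainsWith {K : Type} [Field K] (E : WeierstrassCurve K)
    (T : Type) [AddCommGroup T] {r : ℕ} (x y : Fin r → K) : Prop :=
  ∃ f : T × (Fin r → ℤ) →+ E.toAffine.Point, Function.Injective f ∧
    ∀ i, ∃ h : E.toAffine.Nonsingular (x i) (y i),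
      f (0, Pi.single i 1) = WeierstrassCurve.Affine.Point.some (x i) (y i) h

/-!
Independence is proved by `2`-descent. For a root `e` of the `2`-division polynomial
`4 x³ + b₂ x² + 2 b₄ x + b₆` in a field `F`, the map `(x, y) ↦ x - e` is a homomorphism
`W(F) → Fˣ / (Fˣ)²`, because the product of the values `xᵢ - e` at the three points of the
curve on a line is a square (`Point.isSquare_descent_add`). When
`K` embeds into `ℚ_p`, with `p` odd, and `e` is the lift of a simple root modulo `p`, the residue
of `x - e` gives a quadratic character on the points whose abscissa is integral and not congruent
to `e`; it is trivial on `2 W(K)` (`isSquare_zmod_of_sum_eq_two_smul`). Hence finitely many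
Legendre symbols show that no nonempty subsum of the free generators and of a generator `t` of the
even torsion, if there is any, is divisible by `2`. Since the `2`-torsion over the base field
consists of multiples of `t`, halving the coefficients of a relation forever shows that the relation
is trivial on the free generators
(`eq_zero_of_sum_zsmul_eq_zero_of_independent_mod_two`). With an embedding of the finite group, this
gives the embedding of its product with `ℤ ^ r` (`exists_injective_prod_of_independent`).

Ellipticity and the bound on the `2`-torsion are also read off from a reduction: the discriminant is
a unit at some `p`, and the `2`-division polynomial has no root, or a single simple root, modulo
that `p`. The point `(0, 0)` is a torsion point of order `5`, `9`, `5`, `12` on the four curves, and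
the torsion subgroups are completed by explicit points of order `3` or `2`.

The curves with torsion `ℤ/2 × ℤ/10` and `ℤ/2 × ℤ/12` are defined over `ℚ`, and so are a torsion
point of order `10` or `12` and four independent points: the descent takes place over `ℚ`, and the
quadratic field only contributes the second point of order `2`
(`tateCurve.mordellWeilContainsWith_of_rational`).

The identities between elements of a quadratic field hold modulo the equation of its generator `w`;
the factors in front of that equation in the `linear_combination` steps are the quotients.
-/

/-! ### Independence from classes modulo `2` -/

section Independence

variable {A : Type*} [AddCommGroup A]

/-- Infinite descent: let the `P i` be linearly independent in `A / 2A`, and let every `2`-torsion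
element of `A` be an integral combination of those `P i` with `i ∉ D`. Then in every relation
between the `P i` the coefficients with index in `D` vanish: all coefficients are even, and halving
them produces a relation again, up to `2`-torsion. -/
theorem eq_zero_of_sum_zsmul_eq_zero_of_independent_mod_two {ι : Type*} [Fintype ι] (P : ι → A)
    (D : Finset ι)
    (htor : ∀ a : A, (2 : ℤ) • a = 0 → ∃ c : ι → ℤ, (∀ i ∈ D, c i = 0) ∧ a = ∑ i, c i • P i)
    (hind : ∀ (S : Finset ι) (q : A), ∑ i ∈ S, P i = (2 : ℤ) • q → S = ∅)
    (n : ι → ℤ) (hn : ∑ i, n i • P i = 0) : ∀ i ∈ D, n i = 0 := by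
  classical
  induction hN : ∑ i ∈ D, (n i).natAbs using Nat.strong_induction_on generalizing n with
  | _ N ih =>
    have hdec : ∑ i, n i • P i = (2 : ℤ) • ∑ i, (n i / 2) • P i
        + ∑ i ∈ Finset.univ.filter (fun i => n i % 2 = 1), P i := by
      rw [Finset.smul_sum, Finset.sum_filter, ← Finset.sum_add_distrib]
      refine Finset.sum_congr rfl fun i _ => ?_
      conv_lhs => rw [← Int.mul_ediv_add_emod (n i) 2]
      rcases Int.emod_two_eq_zero_or_one (n i) with h0 | h0 <;> simp [h0, add_smul, mul_smul]
    rw [hdec] at hn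
    have hS := hind _ (-∑ i, (n i / 2) • P i) (by
      rw [smul_neg]; exact eq_neg_of_add_eq_zero_right hn)
    rw [hS, Finset.sum_empty, add_zero] at hn
    have heven : ∀ i, n i % 2 = 0 := fun i => by
      have hi : i ∉ Finset.univ.filter (fun i => n i % 2 = 1) := by rw [hS]; simp
      rw [Finset.mem_filter] at hi
      have := Finset.mem_univ i
      rcases Int.emod_two_eq_zero_or_one (n i) with h0 | h0 <;> tauto
    obtain ⟨c, hcD, hc⟩ := htor _ hn
    by_contra! hne
    obtain ⟨i₀, hi₀, hni₀⟩ := hne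
    have hlt : ∑ i ∈ D, (n i / 2 - c i).natAbs < N := by
      rw [← hN]
      refine Finset.sum_lt_sum (fun i hi => ?_) ⟨i₀, hi₀, ?_⟩
      · rw [hcD i hi]; omega
      · rw [hcD i₀ hi₀]; have := heven i₀; omega
    have h0 := ih _ hlt (fun i => n i / 2 - c i) (by
      simp_rw [sub_smul, Finset.sum_sub_distrib]
      rw [hc, sub_self]) rfl i₀ hi₀
    rw [hcD i₀ hi₀] at h0
    have := heven i₀
    omega

/-- The descent of `eq_zero_of_sum_zsmul_eq_zero_of_independent_mod_two` when the `2`-torsion of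
`A` is generated by a multiple of the last element of the family. -/
theorem eq_zero_of_sum_zsmul_castSucc_eq_zero {r : ℕ} (P : Fin (r + 1) → A)
    (htor : ∀ a : A, (2 : ℤ) • a = 0 → ∃ k : ℤ, a = k • P (Fin.last r))
    (hind : ∀ (S : Finset (Fin (r + 1))) (q : A), ∑ i ∈ S, P i = (2 : ℤ) • q → S = ∅)
    (n : Fin r → ℤ) (hn : ∑ i, n i • P i.castSucc = 0) : n = 0 := by
  have h := eq_zero_of_sum_zsmul_eq_zero_of_independent_mod_two P (Finset.univ.erase (Fin.last r))
    (fun a ha => by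
      obtain ⟨k, rfl⟩ := htor a ha
      refine ⟨Pi.single (Fin.last r) k, fun i hi => ?_, ?_⟩
      · rw [Pi.single_eq_of_ne (Finset.ne_of_mem_erase hi)]
      · rw [Finset.sum_eq_single (Fin.last r)]
        · rw [Pi.single_eq_same]
        · intro i _ hi
          rw [Pi.single_eq_of_ne hi, zero_smul]
        · simp)
    hind (Fin.snoc n 0) (by simpa [Fin.sum_univ_castSucc] using hn)
  funext i
  simpa using h i.castSucc (Finset.mem_erase.mpr ⟨(Fin.castSucc_lt_last i).ne, Finset.mem_univ _⟩)

/-- A finite group `T` embedded by `φ` and elements `g i` that are linearly independent over `ℤ`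
generate together a copy of `T × ℤ ^ r`. -/
theorem exists_injective_prod_of_independent {T : Type*} [AddCommGroup T] [Finite T] {r : ℕ}
    (φ : T →+ A) (hφ : Function.Injective φ) (g : Fin r → A)
    (hg : ∀ n : Fin r → ℤ, ∑ i, n i • g i = 0 → n = 0) :
    ∃ f : T × (Fin r → ℤ) →+ A, Function.Injective f ∧ ∀ i, f (0, Pi.single i 1) = g i := by
  let ψ : (Fin r → ℤ) →+ A :=
    ((Fintype.linearCombination ℤ g) : (Fin r → ℤ) →ₗ[ℤ] A).toAddMonoidHom
  have hψ : ∀ n, ψ n = ∑ i, n i • g i := fun n => by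
    simp [ψ, Fintype.linearCombination_apply]
  refine ⟨φ.coprod ψ, ?_, fun i => ?_⟩
  · rw [injective_iff_map_eq_zero]
    rintro ⟨t, n⟩ h
    rw [AddMonoidHom.coprod_apply] at h
    have hc : (Nat.card T : ℤ) • ψ n = 0 := by
      have h1 : (Nat.card T : ℤ) • φ t = 0 := by
        rw [natCast_zsmul, ← map_nsmul, card_nsmul_eq_zero', map_zero]
      simpa [smul_add, h1] using congrArg ((Nat.card T : ℤ) • ·) h
    have hn : (Nat.card T : ℤ) • n = 0 := by
      apply hg
      rw [← hψ, map_zsmul, hc]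
    have hn0 : n = 0 := by
      rcases smul_eq_zero.mp hn with h0 | h0
      · exact absurd h0 (by exact_mod_cast Nat.card_pos.ne')
      · exact h0
    subst hn0
    rw [map_zero, add_zero] at h
    rw [(injective_iff_map_eq_zero φ).mp hφ t h]; rfl
  · rw [AddMonoidHom.coprod_apply, map_zero, zero_add, hψ, Finset.sum_eq_single i]
    · simp
    · intro j _ hj; simp [hj]
    · simp

end Independence

/-! ### The `2`-descent map attached to a root of the `2`-division polynomial -/

namespace WeierstrassCurve.Affine.Point

section DescentMap

variable {F : Type*} [Field F] [DecidableEq F] (W : WeierstrassCurve.Affine F) (e : F)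

/-- A representative in `F` of the image of a point under the descent map `W(F) → Fˣ / (Fˣ)²`
attached to the root `e` of the `2`-division polynomial: the value `x - e`, replaced at the
`2`-torsion point with `x = e` by the derivative at `e` of `x³ + (b₂/4) x² + (b₄/2) x + b₆/4`. -/
noncomputable def descent : W.Point → F
  | .zero => 1
  | .some x _ _ => if x = e then 3 * e ^ 2 + W.b₂ * e / 2 + W.b₄ / 2 else x - e

@[simp] lemma descent_zero : descent W e 0 = 1 := rfl

variable {W e}

lemma descent_some_of_ne {x y : F} {h : W.Nonsingular x y} (hx : x ≠ e) :
    descent W e (.some x y h) = x - e := if_neg hx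

lemma descent_ne_zero (hF : 3 * e ^ 2 + W.b₂ * e / 2 + W.b₄ / 2 ≠ 0) (P : W.Point) :
    descent W e P ≠ 0 := by
  rcases P with _ | ⟨x, y, h⟩
  · exact one_ne_zero
  · rw [descent]
    split_ifs with hx
    · exact hF
    · exact sub_ne_zero.mpr hx

/-- The descent map is a homomorphism modulo squares. If the line through `P` and `Q` meets the
curve in points with `x`-coordinates `x₁, x₂, x₃`, then `(x₁ - e) (x₂ - e) (x₃ - e)` is the square
of the value at `e` of a linear form; when one of the `xᵢ` equals `e`, the derivative of this
identity at `e` takes its place. -/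
theorem isSquare_descent_add (h2 : (2 : F) ≠ 0)
    (he : 4 * e ^ 3 + W.b₂ * e ^ 2 + 2 * W.b₄ * e + W.b₆ = 0)
    (hF : 3 * e ^ 2 + W.b₂ * e / 2 + W.b₄ / 2 ≠ 0) (P Q : W.Point) :
    IsSquare (descent W e (P + Q) * descent W e P * descent W e Q) := by
  rcases P with _ | ⟨x₁, y₁, h₁⟩
  · change IsSquare (descent W e (0 + Q) * 1 * descent W e Q)
    rw [zero_add, mul_one]
    exact ⟨_, rfl⟩
  rcases Q with _ | ⟨x₂, y₂, h₂⟩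
  · change IsSquare (descent W e (_ + 0) * _ * 1)
    rw [add_zero, mul_one]
    exact ⟨_, rfl⟩
  by_cases hxy : x₁ = x₂ ∧ y₁ = W.negY x₂ y₂
  · rw [add_of_Y_eq hxy.1 hxy.2, descent_zero, one_mul]
    obtain ⟨rfl, -⟩ := hxy
    exact ⟨_, rfl⟩
  rw [add_some hxy]
  have key := addPolynomial_slope h₁.1 h₂.1 hxy
  rw [addPolynomial_eq, neg_inj, Cubic.prod_X_sub_C_eq, Cubic.toPoly_injective,
    Cubic.mk.injEq] at key
  obtain ⟨-, kb, kc, kd⟩ := key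
  set ℓ := W.slope x₁ x₂ y₁ y₂
  set x₃ := W.addX x₁ x₂ ℓ
  set M := 2 * (y₁ + ℓ * (e - x₁)) + W.a₁ * e + W.a₃ with hM
  simp only [WeierstrassCurve.b₂, WeierstrassCurve.b₄, WeierstrassCurve.b₆] at he
  have hprod : (x₃ - e) * (x₁ - e) * (x₂ - e) = (M / 2) ^ 2 := by
    field_simp
    linear_combination 4 * (kb * e ^ 2 + kc * e + kd) - he
  have hder : (e - x₁) * (e - x₂) + (e - x₁) * (e - x₃) + (e - x₂) * (e - x₃)
      = 3 * e ^ 2 + W.b₂ * e / 2 + W.b₄ / 2 - M * (ℓ + W.a₁ / 2) := by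
    simp only [WeierstrassCurve.b₂, WeierstrassCurve.b₄]
    field_simp
    linear_combination -2 * (2 * kb * e + kc)
  have hM0 : (x₃ - e) * (x₁ - e) * (x₂ - e) = 0 → M = 0 := fun h0 => by
    have h1 := pow_eq_zero_iff (two_ne_zero) |>.mp (hprod.symm.trans h0)
    exact (div_eq_zero_iff.mp h1).resolve_right h2
  clear_value M
  simp only [descent]
  generalize 3 * e ^ 2 + W.b₂ * e / 2 + W.b₄ / 2 = D at hF hder ⊢
  by_cases e₁ : x₁ = e
  · rw [hM0 (by rw [e₁]; ring), e₁] at hder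
    have e₂ : x₂ ≠ e := fun h => hF (by rw [h] at hder; linear_combination -hder)
    have e₃ : x₃ ≠ e := fun h => hF (by rw [h] at hder; linear_combination -hder)
    rw [if_pos e₁, if_neg e₂, if_neg e₃]
    exact ⟨D, by linear_combination D * hder⟩
  by_cases e₂ : x₂ = e
  · rw [hM0 (by rw [e₂]; ring), e₂] at hder
    have e₃ : x₃ ≠ e := fun h => hF (by rw [h] at hder; linear_combination -hder)
    rw [if_neg e₁, if_pos e₂, if_neg e₃]
    exact ⟨D, by linear_combination D * hder⟩
  by_cases e₃ : x₃ = e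
  · rw [hM0 (by rw [e₃]; ring), e₃] at hder
    rw [if_neg e₁, if_neg e₂, if_pos e₃]
    exact ⟨D, by linear_combination D * hder⟩
  · rw [if_neg e₁, if_neg e₂, if_neg e₃]
    exact ⟨M / 2, by rw [hprod]; ring⟩

/-- If `∑ Pᵢ ∈ 2 W(F)`, then the product of the descent values of the `Pᵢ` is a square. -/
theorem isSquare_prod_descent_of_sum_eq_two_smul (h2 : (2 : F) ≠ 0)
    (he : 4 * e ^ 3 + W.b₂ * e ^ 2 + 2 * W.b₄ * e + W.b₆ = 0)
    (hF : 3 * e ^ 2 + W.b₂ * e / 2 + W.b₄ / 2 ≠ 0) {ι : Type*} (S : Finset ι) (P : ι → W.Point)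
    (Q : W.Point) (hQ : ∑ i ∈ S, P i = (2 : ℤ) • Q) :
    IsSquare (∏ i ∈ S, descent W e (P i)) := by
  classical
  have hne := descent_ne_zero hF
  have cancel : ∀ a b c : F, b ≠ 0 → IsSquare (a * b) → IsSquare (b * c) → IsSquare (a * c) := by
    rintro a b c hb ⟨u, hu⟩ ⟨v, hv⟩
    refine ⟨u * v / b, ?_⟩
    field_simp
    linear_combination (b * c) * hu + u ^ 2 * hv
  have hsum : ∀ S : Finset ι,
      IsSquare (descent W e (∑ i ∈ S, P i) * ∏ i ∈ S, descent W e (P i)) := by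
    intro S
    induction S using Finset.induction_on with
    | empty => exact ⟨1, by simp⟩
    | insert i S hi ih =>
      rw [Finset.sum_insert hi, Finset.prod_insert hi, ← mul_assoc]
      exact cancel _ _ _ (hne _) (isSquare_descent_add h2 he hF (P i) (∑ i ∈ S, P i)) ih
  have h2Q : IsSquare (descent W e ((2 : ℤ) • Q)) := by
    have := isSquare_descent_add h2 he hF Q Q
    obtain ⟨u, hu⟩ := this
    refine ⟨u / descent W e Q, ?_⟩
    have := hne Q
    rw [two_zsmul]
    field_simp
    linear_combination hu
  have := hsum S
  rw [hQ] at this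
  simpa using cancel 1 _ _ (hne _) (by simpa using h2Q) this

end DescentMap

/-! ### Base change of points along a field embedding -/

section MapHom

variable {F L : Type*} [Field F] [Field L] [DecidableEq F] [DecidableEq L]
  (W : WeierstrassCurve.Affine F) (σ : F →+* L)

/-- The homomorphism `W(F) → W(L)` induced by a field embedding `σ : F → L`. -/
noncomputable def mapHom : W.Point →+ (W.map σ).toAffine.Point where
  toFun P := match P with
    | .zero => 0
    | .some x y h => .some (σ x) (σ y) ((W.map_nonsingular σ.injective ..).mpr h)
  map_zero' := rfl
  map_add' := by
    rintro (_ | ⟨x₁, y₁, h₁⟩) (_ | ⟨x₂, y₂, h₂⟩)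
    any_goals rfl
    by_cases hxy : x₁ = x₂ ∧ y₁ = W.negY x₂ y₂
    · rw [add_of_Y_eq hxy.1 hxy.2]
      exact (add_of_Y_eq (congrArg σ hxy.1) (by rw [hxy.2, map_negY])).symm
    · have hxy' : ¬ (σ x₁ = σ x₂ ∧ σ y₁ = (W.map σ).toAffine.negY (σ x₂) (σ y₂)) := by
        rw [map_negY]
        exact fun h => hxy ⟨σ.injective h.1, σ.injective h.2⟩
      rw [add_some hxy]
      refine Eq.trans ?_ (add_some hxy').symm
      simp only [map_slope, map_addX, map_addY]

lemma mapHom_some {x y : F} (h : W.Nonsingular x y) :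
    mapHom W σ (.some x y h) =
      .some (σ x) (σ y) ((W.map_nonsingular σ.injective ..).mpr h) := rfl

lemma mapHom_injective : Function.Injective (mapHom W σ) := by
  rintro (_ | ⟨x₁, y₁, h₁⟩) (_ | ⟨x₂, y₂, h₂⟩) h
  · rfl
  · cases h
  · cases h
  · rw [mapHom_some, mapHom_some] at h
    injection h with hx hy
    obtain rfl := σ.injective hx
    obtain rfl := σ.injective hy
    rfl

variable {W} in
/-- The homomorphism `W(F) → V(L)` induced by a field embedding `σ : F → L`, where `V` is the base
change of `W` along `σ`. -/
noncomputable def mapHomOfEq {V : WeierstrassCurve.Affine L} (hV : W.map σ = V) :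
    W.Point →+ V.Point :=
  hV ▸ mapHom W σ

variable {W} in
lemma mapHomOfEq_some {V : WeierstrassCurve.Affine L} (hV : W.map σ = V) {x y : F}
    (h : W.Nonsingular x y) {x' y' : L} (hx : σ x = x') (hy : σ y = y') :
    ∃ h', mapHomOfEq σ hV (.some x y h) = .some x' y' h' := by
  subst hV hx hy
  exact ⟨_, rfl⟩

variable {W} in
lemma mapHomOfEq_injective {V : WeierstrassCurve.Affine L} (hV : W.map σ = V) :
    Function.Injective (mapHomOfEq σ hV) := by
  subst hV
  exact mapHom_injective W σ

end MapHom

end WeierstrassCurve.Affine.Point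

/-! ### Reduction of `p`-adic numbers -/

section Reduction

variable {p : ℕ} [Fact p.Prime]

/-- The `p`-adic number `z` is integral and congruent to the integer `s` modulo `p`. -/
def PadicReduces (z : ℚ_[p]) (s : ℤ) : Prop :=
  ∃ z' : ℤ_[p], (z' : ℚ_[p]) = z ∧ PadicInt.toZMod z' = (s : ZMod p)

lemma PadicInt.toZMod_eq_zero_iff_norm_lt_one (z : ℤ_[p]) : PadicInt.toZMod z = 0 ↔ ‖z‖ < 1 := by
  rw [← RingHom.mem_ker, PadicInt.ker_toZMod, IsLocalRing.mem_maximalIdeal, PadicInt.mem_nonunits]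

namespace PadicReduces

variable {z w : ℚ_[p]} {s t : ℤ}

lemma intCast (s : ℤ) : PadicReduces (s : ℚ_[p]) s := ⟨s, by simp, by simp⟩

lemma ofNat (n : ℕ) [n.AtLeastTwo] : PadicReduces (OfNat.ofNat n : ℚ_[p]) (OfNat.ofNat n) := by
  simpa using intCast (p := p) (OfNat.ofNat n)

lemma add (hz : PadicReduces z s) (hw : PadicReduces w t) : PadicReduces (z + w) (s + t) := by
  obtain ⟨z', rfl, hz⟩ := hz
  obtain ⟨w', rfl, hw⟩ := hw
  exact ⟨z' + w', by simp, by simp [hz, hw]⟩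

lemma sub (hz : PadicReduces z s) (hw : PadicReduces w t) : PadicReduces (z - w) (s - t) := by
  obtain ⟨z', rfl, hz⟩ := hz
  obtain ⟨w', rfl, hw⟩ := hw
  exact ⟨z' - w', by simp, by simp [hz, hw]⟩

lemma neg (hz : PadicReduces z s) : PadicReduces (-z) (-s) := by
  obtain ⟨z', rfl, hz⟩ := hz
  exact ⟨-z', by simp, by simp [hz]⟩

lemma mul (hz : PadicReduces z s) (hw : PadicReduces w t) : PadicReduces (z * w) (s * t) := by
  obtain ⟨z', rfl, hz⟩ := hz
  obtain ⟨w', rfl, hw⟩ := hw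
  exact ⟨z' * w', by simp, by simp [hz, hw]⟩

lemma pow (hz : PadicReduces z s) (n : ℕ) : PadicReduces (z ^ n) (s ^ n) := by
  obtain ⟨z', rfl, hz⟩ := hz
  exact ⟨z' ^ n, by simp, by simp [hz]⟩

lemma prod {ι : Type*} (S : Finset ι) {z : ι → ℚ_[p]} {s : ι → ℤ}
    (h : ∀ i, PadicReduces (z i) (s i)) : PadicReduces (∏ i ∈ S, z i) (∏ i ∈ S, s i) := by
  classical
  induction S using Finset.induction_on with
  | empty => simpa using intCast (p := p) 1
  | insert i S hi ih => rw [Finset.prod_insert hi, Finset.prod_insert hi]; exact (h i).mul ih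

lemma norm_eq_one {z' : ℤ_[p]} (hz : PadicInt.toZMod z' = (s : ZMod p)) (hs : ¬ (p : ℤ) ∣ s) :
    ‖z'‖ = 1 := by
  refine le_antisymm z'.norm_le_one (not_lt.mp fun h => hs ?_)
  rw [← PadicInt.toZMod_eq_zero_iff_norm_lt_one, hz, ZMod.intCast_zmod_eq_zero_iff_dvd] at h
  exact h

/-- The quotient of two integral `p`-adic numbers with unit denominator. -/
lemma div (hz : PadicReduces z s) (hw : PadicReduces w t) (r : ℤ) (ht : ¬ (p : ℤ) ∣ t)
    (h : (p : ℤ) ∣ s - r * t) : PadicReduces (z / w) r := by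
  obtain ⟨z', rfl, hz⟩ := hz
  obtain ⟨w', rfl, hw⟩ := hw
  have hu : IsUnit w' := PadicInt.isUnit_iff.mpr (norm_eq_one hw ht)
  obtain ⟨u, rfl⟩ := hu
  refine ⟨z' * (u⁻¹ : ℤ_[p]ˣ), ?_, ?_⟩
  · have h1 : ((u : ℤ_[p]) : ℚ_[p]) * ((u⁻¹ : ℤ_[p]ˣ) : ℤ_[p]) = 1 := by
      rw [← PadicInt.coe_mul, Units.mul_inv, PadicInt.coe_one]
    rw [PadicInt.coe_mul, eq_div_iff (left_ne_zero_of_mul_eq_one h1)]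
    linear_combination (z' : ℚ_[p]) * h1
  · have ht0 : (t : ZMod p) ≠ 0 := fun h0 => ht ((ZMod.intCast_zmod_eq_zero_iff_dvd t p).mp h0)
    have h1 : PadicInt.toZMod (u : ℤ_[p]) * PadicInt.toZMod ((u⁻¹ : ℤ_[p]ˣ) : ℤ_[p]) = 1 := by
      rw [← map_mul, Units.mul_inv, map_one]
    have h2 : (s : ZMod p) = r * t := by
      rw [← sub_eq_zero]
      exact_mod_cast (ZMod.intCast_zmod_eq_zero_iff_dvd _ p).mpr h
    rw [map_mul, hz]
    apply mul_right_cancel₀ ht0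
    rw [hw] at h1
    linear_combination (s : ZMod p) * h1 + h2

lemma ne_zero (hz : PadicReduces z s) (hs : ¬ (p : ℤ) ∣ s) : z ≠ 0 := by
  obtain ⟨z', rfl, hz⟩ := hz
  rintro h0
  have := norm_eq_one hz hs
  rw [← PadicInt.padic_norm_e_of_padicInt, h0] at this
  simp at this

/-- The residue of a square unit is a square. -/
lemma isSquare_residue (hz : PadicReduces z s) (hs : ¬ (p : ℤ) ∣ s) (hsq : IsSquare z) :
    IsSquare (s : ZMod p) := by
  obtain ⟨z', rfl, hz⟩ := hz
  obtain ⟨u, hu⟩ := hsq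
  have h1 : ‖u‖ * ‖u‖ = 1 := by
    rw [← norm_mul, ← hu, PadicInt.padic_norm_e_of_padicInt, norm_eq_one hz hs]
  have h2 : ‖u‖ ≤ 1 := by nlinarith [norm_nonneg u]
  obtain ⟨u', rfl⟩ : ∃ u' : ℤ_[p], (u' : ℚ_[p]) = u := ⟨⟨u, h2⟩, rfl⟩
  refine ⟨PadicInt.toZMod u', ?_⟩
  rw [← map_mul, ← hz]
  exact congrArg _ (PadicInt.ext (by rw [hu, PadicInt.coe_mul]))

open Polynomial in
/-- Hensel's lemma for polynomials of degree at most three: a simple root modulo `p` lifts. -/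
theorem exists_root_of_simple_root_mod {c₃ c₂ c₁ c₀ : ℚ_[p]} {s₃ s₂ s₁ s₀ : ℤ}
    (h₃ : PadicReduces c₃ s₃) (h₂ : PadicReduces c₂ s₂) (h₁ : PadicReduces c₁ s₁)
    (h₀ : PadicReduces c₀ s₀) (r : ℤ) (hr : (p : ℤ) ∣ s₃ * r ^ 3 + s₂ * r ^ 2 + s₁ * r + s₀)
    (hr' : ¬ (p : ℤ) ∣ 3 * s₃ * r ^ 2 + 2 * s₂ * r + s₁) :
    ∃ e : ℚ_[p], c₃ * e ^ 3 + c₂ * e ^ 2 + c₁ * e + c₀ = 0 ∧ PadicReduces e r := by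
  obtain ⟨d₃, rfl, h₃⟩ := h₃
  obtain ⟨d₂, rfl, h₂⟩ := h₂
  obtain ⟨d₁, rfl, h₁⟩ := h₁
  obtain ⟨d₀, rfl, h₀⟩ := h₀
  let f : ℤ_[p][X] := C d₃ * X ^ 3 + C d₂ * X ^ 2 + C d₁ * X + C d₀
  have hf : ∀ z, f.aeval z = d₃ * z ^ 3 + d₂ * z ^ 2 + d₁ * z + d₀ := fun z => by
    simp [f]
  have hf' : f.derivative.aeval (r : ℤ_[p]) = 3 * d₃ * r ^ 2 + 2 * d₂ * r + d₁ := by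
    simp [f, derivative_mul]
    ring
  have hn0 : ‖f.aeval (r : ℤ_[p])‖ < 1 := by
    rw [← PadicInt.toZMod_eq_zero_iff_norm_lt_one, hf]
    simp only [map_add, map_mul, map_pow, map_intCast, h₃, h₂, h₁, h₀]
    exact_mod_cast (ZMod.intCast_zmod_eq_zero_iff_dvd _ p).mpr hr
  have hn1 : ‖f.derivative.aeval (r : ℤ_[p])‖ = 1 := by
    refine norm_eq_one (s := 3 * s₃ * r ^ 2 + 2 * s₂ * r + s₁) ?_ hr'
    rw [hf']
    simp [h₃, h₂, h₁, map_ofNat]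
  obtain ⟨z, hz, hzr, -⟩ := hensels_lemma (F := f) (a := (r : ℤ_[p]))
    (by rw [hn1, one_pow]; exact hn0)
  refine ⟨z, ?_, z, rfl, ?_⟩
  · rw [hf] at hz
    simpa using congrArg (fun z : ℤ_[p] => (z : ℚ_[p])) hz
  · rw [hn1, ← PadicInt.toZMod_eq_zero_iff_norm_lt_one, map_sub, map_intCast, sub_eq_zero] at hzr
    exact hzr

end PadicReduces

end Reduction

/-! ### Quadratic characters detecting classes modulo `2` -/

open WeierstrassCurve.Affine in
/-- Let `σ` embed `K` into `ℚ_p`, with `p` odd, and let `e` be a simple root modulo `p` of the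
`2`-division polynomial of `W`. If a sum of points with `x`-coordinates congruent to `X i` is
divisible by `2` in `W(K)`, then `∏ (X i - e)` is a square modulo `p`: the descent map over `ℚ_p`
at the root lifting `e` sends the sum to a square unit. -/
theorem isSquare_zmod_of_sum_eq_two_smul {p : ℕ} [Fact p.Prime] (hp2 : ¬ (p : ℤ) ∣ 2) {K : Type*}
    [Field K] [DecidableEq K] (W : WeierstrassCurve.Affine K) (σ : K →+* ℚ_[p]) {B₂ B₄ B₆ e : ℤ}
    (h₂ : PadicReduces (σ W.b₂) B₂) (h₄ : PadicReduces (σ W.b₄) B₄)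
    (h₆ : PadicReduces (σ W.b₆) B₆) (he : (p : ℤ) ∣ 4 * e ^ 3 + B₂ * e ^ 2 + 2 * B₄ * e + B₆)
    (he' : ¬ (p : ℤ) ∣ 3 * 4 * e ^ 2 + 2 * B₂ * e + 2 * B₄) {ι : Type*} {x y : ι → K}
    (h : ∀ i, W.Nonsingular (x i) (y i)) {X : ι → ℤ} (hX : ∀ i, PadicReduces (σ (x i)) (X i))
    (hXe : ∀ i, ¬ (p : ℤ) ∣ X i - e) (S : Finset ι) (Q : W.Point)
    (hQ : ∑ i ∈ S, Point.some _ _ (h i) = (2 : ℤ) • Q) :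
    IsSquare ((∏ i ∈ S, (X i - e) : ℤ) : ZMod p) := by
  classical
  obtain ⟨ε, hε, hεe⟩ := PadicReduces.exists_root_of_simple_root_mod
    (PadicReduces.ofNat (p := p) 4) h₂ ((PadicReduces.ofNat (p := p) 2).mul h₄) h₆ e he he'
  have h2 : (2 : ℚ_[p]) ≠ 0 := (PadicReduces.ofNat (p := p) 2).ne_zero hp2
  have hF : 3 * ε ^ 2 + (W.map σ).b₂ * ε / 2 + (W.map σ).b₄ / 2 ≠ 0 := by
    have := (((((PadicReduces.ofNat (p := p) 3).mul (PadicReduces.ofNat (p := p) 4)).mul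
      (hεe.pow 2)).add (((PadicReduces.ofNat (p := p) 2).mul h₂).mul hεe)).add
      ((PadicReduces.ofNat (p := p) 2).mul h₄)).ne_zero he'
    rw [WeierstrassCurve.map_b₂, WeierstrassCurve.map_b₄]
    intro h0
    apply this
    field_simp at h0
    linear_combination 2 * h0
  have hne : ∀ i, σ (x i) ≠ ε := fun i h0 => ((hX i).sub hεe).ne_zero (hXe i) (sub_eq_zero.mpr h0)
  have hsq := Point.isSquare_prod_descent_of_sum_eq_two_smul (W := W.map σ) (e := ε) h2
    (by rw [WeierstrassCurve.map_b₂, WeierstrassCurve.map_b₄, WeierstrassCurve.map_b₆]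
        linear_combination hε) hF S (fun i => Point.mapHom W σ (.some _ _ (h i)))
    (Point.mapHom W σ Q) (by rw [← map_sum, hQ, map_zsmul])
  have hred := PadicReduces.prod S (fun i => (hX i).sub hεe)
  refine hred.isSquare_residue ?_ ?_
  · rw [Prime.dvd_finsetProd_iff (Nat.prime_iff_prime_int.mp Fact.out)]
    rintro ⟨i, -, hi⟩
    exact hXe i hi
  · have hprod : ∏ i ∈ S, (σ (x i) - ε) = ∏ i ∈ S, Point.descent (W.map σ) ε
        (Point.mapHom W σ (.some _ _ (h i))) := Finset.prod_congr rfl fun i _ => by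
      rw [Point.mapHom_some, Point.descent_some_of_ne (hne i)]
    rwa [hprod]

/-! ### Torsion subgroups -/

section Torsion

variable {A : Type*} [AddCommGroup A]

/-- An element of order `n` gives an embedding of `ℤ/n`. -/
theorem exists_injective_zmod_of_addOrderOf_eq (t : A) (n : ℕ) (ht : addOrderOf t = n) :
    ∃ φ : ZMod n →+ A, Function.Injective φ ∧ ∀ k : ℤ, φ k = k • t := by
  have h0 : zmultiplesHom A t n = 0 := by
    rw [zmultiplesHom_apply, natCast_zsmul, ← ht, addOrderOf_nsmul_eq_zero]
  refine ⟨ZMod.lift n ⟨zmultiplesHom A t, h0⟩, ?_, fun k => ?_⟩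
  · rw [ZMod.lift_injective]
    intro m hm
    rw [zmultiplesHom_apply, ← addOrderOf_dvd_iff_zsmul_eq_zero, ht] at hm
    exact (ZMod.intCast_zmod_eq_zero_iff_dvd m n).mpr hm
  · rw [ZMod.lift_coe]; rfl

/-- An element `t` of even order `2 m` and an element `s` of order `2` other than `m • t` give an
embedding of `ℤ/2 × ℤ/(2m)`. -/
theorem exists_injective_zmod_two_prod_zmod (s t : A) (m : ℕ) (ht : addOrderOf t = 2 * m)
    (hs : addOrderOf s = 2) (hst : s ≠ m • t) :
    ∃ φ : ZMod 2 × ZMod (2 * m) →+ A, Function.Injective φ := by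
  obtain ⟨φ, hφ, hφs⟩ := exists_injective_zmod_of_addOrderOf_eq s 2 hs
  obtain ⟨ψ, hψ, hψt⟩ := exists_injective_zmod_of_addOrderOf_eq t (2 * m) ht
  refine ⟨φ.coprod ψ, ?_⟩
  rw [injective_iff_map_eq_zero]
  rintro ⟨a, b⟩ hab
  rw [AddMonoidHom.coprod_apply] at hab
  have ha : a = 0 := by
    by_contra ha
    obtain rfl : a = 1 := (show ∀ a : ZMod 2, a ≠ 0 → a = 1 by decide) a ha
    have h1 : φ 1 = s := by simpa using hφs 1
    obtain ⟨k, rfl⟩ := ZMod.intCast_surjective b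
    simp only [h1, hψt] at hab
    have h2k : (2 * k) • t = 0 := by
      have h2s : (2 : ℤ) • s = 0 := by
        rw [← addOrderOf_dvd_iff_zsmul_eq_zero, hs]; rfl
      have := congrArg ((2 : ℤ) • ·) hab
      simpa [smul_add, h2s, mul_smul] using this
    rw [← addOrderOf_dvd_iff_zsmul_eq_zero, ht] at h2k
    have hmk : (m : ℤ) ∣ k := by
      push_cast at h2k
      exact (mul_dvd_mul_iff_left two_ne_zero).mp h2k
    obtain ⟨j, rfl⟩ := hmk
    have hs0 : s ≠ 0 := by rintro rfl; simp at hs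
    have hmt : (2 * (m : ℤ)) • t = 0 := by
      rw [← addOrderOf_dvd_iff_zsmul_eq_zero, ht]; push_cast; rfl
    rcases Int.even_or_odd' j with ⟨i, rfl | rfl⟩
    · rw [show (m : ℤ) * (2 * i) = i * (2 * m) by ring, mul_smul, hmt, smul_zero, add_zero] at hab
      exact hs0 hab
    · rw [show (m : ℤ) * (2 * i + 1) = (i + 1) * (2 * m) - m by ring, sub_smul, mul_smul, hmt,
        smul_zero, zero_sub, natCast_zsmul, ← sub_eq_add_neg, sub_eq_zero] at hab
      exact hst hab
  subst ha
  rw [map_zero, zero_add] at hab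
  rw [(injective_iff_map_eq_zero ψ).mp hψ b hab]
  rfl

lemma nsmul_add_eq_left_of_addOrderOf {s t : A} {m : ℕ} (hs : addOrderOf s = 2)
    (ht : addOrderOf t = m) (hm : Odd m) : m • (s + t) = s := by
  obtain ⟨k, rfl⟩ := hm
  have hs2 : 2 • s = 0 := by rw [← hs]; exact addOrderOf_nsmul_eq_zero s
  rw [nsmul_add, ← ht, addOrderOf_nsmul_eq_zero, ht, add_zero, succ_nsmul, mul_comm, mul_nsmul',
    hs2, nsmul_zero, zero_add]

lemma addOrderOf_add_eq_two_mul {s t : A} {m : ℕ} (hs : addOrderOf s = 2) (ht : addOrderOf t = m)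
    (hm : Odd m) : addOrderOf (s + t) = 2 * m := by
  rw [(AddCommute.all s t).addOrderOf_add_eq_mul_addOrderOf_of_coprime, hs, ht]
  rw [hs, ht]
  exact Nat.coprime_two_left.mpr hm

end Torsion

namespace WeierstrassCurve.Affine.Point

variable {F : Type*} [Field F] [DecidableEq F] {W : WeierstrassCurve.Affine F}

/-- Addition of points with distinct `x`-coordinates, given the slope `ℓ` of their chord. -/
lemma some_add_some_eq {x₁ y₁ x₂ y₂ x₃ y₃ : F} (h₁ : W.Nonsingular x₁ y₁)
    (h₂ : W.Nonsingular x₂ y₂) (h₃ : W.Nonsingular x₃ y₃) (ℓ : F) (hx : x₁ ≠ x₂)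
    (hℓ : ℓ * (x₁ - x₂) = y₁ - y₂) (hx₃ : x₃ = ℓ ^ 2 + W.a₁ * ℓ - W.a₂ - x₁ - x₂)
    (hy₃ : y₃ = -(ℓ * (x₃ - x₁) + y₁) - W.a₁ * x₃ - W.a₃) :
    some x₁ y₁ h₁ + some x₂ y₂ h₂ = some x₃ y₃ h₃ := by
  have hs : W.slope x₁ x₂ y₁ y₂ = ℓ := by
    rw [slope_of_X_ne hx, div_eq_iff (sub_ne_zero.mpr hx), hℓ]
  subst hx₃
  rw [add_of_X_ne hx]
  congr 1 <;> rw [hs]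
  · rfl
  · rw [hy₃]; rfl

/-- Duplication of a point, given the slope `ℓ` of its tangent line. -/
lemma two_nsmul_some_eq {x₁ y₁ x₃ y₃ : F} (h₁ : W.Nonsingular x₁ y₁)
    (h₃ : W.Nonsingular x₃ y₃) (ℓ : F) (hy : 2 * y₁ + W.a₁ * x₁ + W.a₃ ≠ 0)
    (hℓ : ℓ * (2 * y₁ + W.a₁ * x₁ + W.a₃) = 3 * x₁ ^ 2 + 2 * W.a₂ * x₁ + W.a₄ - W.a₁ * y₁)
    (hx₃ : x₃ = ℓ ^ 2 + W.a₁ * ℓ - W.a₂ - 2 * x₁)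
    (hy₃ : y₃ = -(ℓ * (x₃ - x₁) + y₁) - W.a₁ * x₃ - W.a₃) :
    2 • some x₁ y₁ h₁ = some x₃ y₃ h₃ := by
  have hy' : y₁ - W.negY x₁ y₁ = 2 * y₁ + W.a₁ * x₁ + W.a₃ := by rw [negY]; ring
  have hne : y₁ ≠ W.negY x₁ y₁ := fun h => hy (by rw [← hy', ← h, sub_self])
  have hs : W.slope x₁ x₁ y₁ y₁ = ℓ := by
    rw [slope_of_Y_ne rfl hne, hy', div_eq_iff hy, hℓ]
  subst hx₃
  rw [two_nsmul, add_self_of_Y_ne hne]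
  congr 1 <;> rw [hs]
  · rw [addX]; ring
  · rw [hy₃, addY, negAddY, negY, addX]; ring

lemma two_nsmul_some_eq_zero {x y : F} (h : W.Nonsingular x y)
    (hy : 2 * y + W.a₁ * x + W.a₃ = 0) : 2 • some x y h = 0 := by
  rw [two_nsmul, add_self_of_Y_eq]
  rw [negY]; linear_combination hy

/-- The coordinates of a point of order `2`: its `x`-coordinate is a root of the `2`-division
polynomial. -/
lemma eq_some_of_two_zsmul_eq_zero {P : W.Point} (hP : (2 : ℤ) • P = 0) (h0 : P ≠ 0) :
    ∃ x y h, P = some x y h ∧ 2 * y + W.a₁ * x + W.a₃ = 0 ∧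
      4 * x ^ 3 + W.b₂ * x ^ 2 + 2 * W.b₄ * x + W.b₆ = 0 := by
  rcases P with _ | ⟨x, y, h⟩
  · exact absurd rfl h0
  refine ⟨x, y, h, rfl, ?_⟩
  have hy : y = W.negY x y := by
    by_contra hne
    rw [two_zsmul, add_self_of_Y_ne hne] at hP
    exact some_ne_zero _ hP
  have hy' : 2 * y + W.a₁ * x + W.a₃ = 0 := by
    rw [negY] at hy; linear_combination hy
  refine ⟨hy', ?_⟩
  have heq := (equation_iff ..).mp h.1
  simp only [WeierstrassCurve.b₂, WeierstrassCurve.b₄, WeierstrassCurve.b₆]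
  linear_combination (2 * y + W.a₁ * x + W.a₃) * hy' - 4 * heq

/-- All points of order `2` of `W` are accounted for by the point with `x`-coordinate `x₀`, if
`x₀` is the only root of the `2`-division polynomial. -/
lemma eq_some_of_two_zsmul_eq_zero_of_unique_root (h2 : (2 : F) ≠ 0) {x₀ y₀ : F}
    (h₀ : W.Nonsingular x₀ y₀) (hy₀ : 2 * y₀ + W.a₁ * x₀ + W.a₃ = 0)
    (huniq : ∀ x : F, 4 * x ^ 3 + W.b₂ * x ^ 2 + 2 * W.b₄ * x + W.b₆ = 0 → x = x₀)
    {P : W.Point} (hP : (2 : ℤ) • P = 0) : P = 0 ∨ P = some x₀ y₀ h₀ := by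
  by_cases h0 : P = 0
  · exact Or.inl h0
  obtain ⟨x, y, h, rfl, hy, hx⟩ := eq_some_of_two_zsmul_eq_zero hP h0
  obtain rfl := huniq x hx
  right
  obtain rfl : y = y₀ := mul_left_cancel₀ h2 (by linear_combination hy - hy₀)
  rfl

end WeierstrassCurve.Affine.Point

/-! ### Roots of the `2`-division polynomial over `ℚ_p` -/

namespace PadicReduces

variable {p : ℕ} [Fact p.Prime]

/-- A `p`-adic root of a cubic polynomial with integral coefficients and unit leading coefficient
is integral, and reduces to a root modulo `p`. -/
theorem exists_root_mod {c₃ c₂ c₁ c₀ x : ℚ_[p]} {s₃ s₂ s₁ s₀ : ℤ}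
    (h₃ : PadicReduces c₃ s₃) (h₂ : PadicReduces c₂ s₂) (h₁ : PadicReduces c₁ s₁)
    (h₀ : PadicReduces c₀ s₀) (hs₃ : ¬ (p : ℤ) ∣ s₃)
    (hx : c₃ * x ^ 3 + c₂ * x ^ 2 + c₁ * x + c₀ = 0) :
    ∃ r : ℕ, r < p ∧ PadicReduces x r ∧ (p : ℤ) ∣ s₃ * r ^ 3 + s₂ * r ^ 2 + s₁ * r + s₀ := by
  have hzero : ∀ {s : ℤ}, PadicReduces (0 : ℚ_[p]) s → (p : ℤ) ∣ s := fun {s} h => by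
    by_contra hs
    exact h.ne_zero hs rfl
  by_cases hn : ‖x‖ ≤ 1
  · obtain ⟨x', rfl⟩ : ∃ x' : ℤ_[p], (x' : ℚ_[p]) = x := ⟨⟨x, hn⟩, rfl⟩
    have hred : PadicReduces (x' : ℚ_[p]) (PadicInt.toZMod x').val :=
      ⟨x', rfl, by rw [Int.cast_natCast, ZMod.natCast_zmod_val]⟩
    refine ⟨(PadicInt.toZMod x').val, ZMod.val_lt _, hred, hzero ?_⟩
    rw [← hx]
    exact (((h₃.mul (hred.pow 3)).add (h₂.mul (hred.pow 2))).add (h₁.mul hred)).add h₀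
  · exfalso
    push Not at hn
    have hx0 : x ≠ 0 := by rintro rfl; simp at hn; linarith
    have hn' : ‖x⁻¹‖ < 1 := by rw [norm_inv]; exact inv_lt_one_of_one_lt₀ hn
    obtain ⟨z, hz⟩ : ∃ z : ℤ_[p], (z : ℚ_[p]) = x⁻¹ := ⟨⟨x⁻¹, hn'.le⟩, rfl⟩
    have hred : PadicReduces x⁻¹ 0 := ⟨z, hz, by
      rw [Int.cast_zero, PadicInt.toZMod_eq_zero_iff_norm_lt_one,
        ← PadicInt.padic_norm_e_of_padicInt, hz]
      exact hn'⟩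
    apply hs₃
    have := ((h₃.add (h₂.mul hred)).add (h₁.mul (hred.pow 2))).add (h₀.mul (hred.pow 3))
    rw [show c₃ + c₂ * x⁻¹ + c₁ * x⁻¹ ^ 2 + c₀ * x⁻¹ ^ 3 = 0 by
      field_simp; linear_combination hx] at this
    simpa using hzero this

/-- If `s` is the only root modulo `p` of a cubic polynomial with unit leading coefficient, and it
is a simple root, then the polynomial has at most one `p`-adic root. -/
theorem root_unique {c₃ c₂ c₁ c₀ x x₀ : ℚ_[p]} {s₃ s₂ s₁ s₀ : ℤ}
    (h₃ : PadicReduces c₃ s₃) (h₂ : PadicReduces c₂ s₂) (h₁ : PadicReduces c₁ s₁)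
    (h₀ : PadicReduces c₀ s₀) (hs₃ : ¬ (p : ℤ) ∣ s₃) (s : ℕ)
    (hs : ∀ r : ℕ, r < p → (p : ℤ) ∣ s₃ * r ^ 3 + s₂ * r ^ 2 + s₁ * r + s₀ → r = s)
    (hs' : ¬ (p : ℤ) ∣ 3 * s₃ * s ^ 2 + 2 * s₂ * s + s₁)
    (hx : c₃ * x ^ 3 + c₂ * x ^ 2 + c₁ * x + c₀ = 0)
    (hx₀ : c₃ * x₀ ^ 3 + c₂ * x₀ ^ 2 + c₁ * x₀ + c₀ = 0) : x = x₀ := by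
  obtain ⟨r, hr, hxr, hrp⟩ := exists_root_mod h₃ h₂ h₁ h₀ hs₃ hx
  obtain ⟨r₀, hr₀, hxr₀, hrp₀⟩ := exists_root_mod h₃ h₂ h₁ h₀ hs₃ hx₀
  obtain rfl := hs r hr hrp
  obtain rfl := hs r₀ hr₀ hrp₀
  have hne := (((h₃.mul (((hxr.pow 2).add (hxr.mul hxr₀)).add (hxr₀.pow 2))).add
    (h₂.mul (hxr.add hxr₀))).add h₁).ne_zero (fun h => hs' (by convert h using 1; ring))
  rw [← sub_eq_zero]
  refine (mul_eq_zero.mp ?_).resolve_right hne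
  linear_combination hx - hx₀

end PadicReduces

/-! ### Curves in Tate form -/

namespace tateCurve

open WeierstrassCurve.Affine

section Basic

variable {K : Type} [Field K] (a b : K)

lemma b₂_eq : (tateCurve a b).b₂ = a ^ 2 + 4 * b := rfl

lemma b₄_eq : (tateCurve a b).b₄ = a * b := by
  simp [WeierstrassCurve.b₄, tateCurve]

lemma b₆_eq : (tateCurve a b).b₆ = b ^ 2 := by
  simp [WeierstrassCurve.b₆, tateCurve]

lemma Δ_eq : (tateCurve a b).Δ =
    b ^ 3 * (-(a ^ 2 + 4 * b) ^ 2 - 8 * a ^ 3 - 27 * b + 9 * (a ^ 2 + 4 * b) * a) := by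
  simp [WeierstrassCurve.Δ, WeierstrassCurve.b₂, WeierstrassCurve.b₄, WeierstrassCurve.b₆,
    WeierstrassCurve.b₈, tateCurve]
  ring

variable {a b}

lemma nonsingular [(tateCurve a b).IsElliptic] {x y : K}
    (h : y ^ 2 + a * x * y + b * y = x ^ 3 + b * x ^ 2) :
    (tateCurve a b).toAffine.Nonsingular x y := by
  rw [← equation_iff_nonsingular, equation_iff]
  simpa [tateCurve] using h

lemma map_eq {L : Type} [Field L] (σ : K →+* L) {a' b' : L} (ha : σ a = a') (hb : σ b = b') :
    (tateCurve a b).map σ = tateCurve a' b' := by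
  subst ha hb
  ext <;> simp [tateCurve]

end Basic

section Reduction

variable {K : Type} [Field K] {a b : K} {p : ℕ} [Fact p.Prime] (σ : K →+* ℚ_[p])
  {α β : ℤ}

lemma reduces_b₂ (ha : PadicReduces (σ a) α) (hb : PadicReduces (σ b) β) :
    PadicReduces (σ (tateCurve a b).b₂) (α ^ 2 + 4 * β) := by
  rw [b₂_eq, map_add, map_mul, map_pow, map_ofNat]
  exact (ha.pow 2).add ((PadicReduces.ofNat (p := p) 4).mul hb)

lemma reduces_b₄ (ha : PadicReduces (σ a) α) (hb : PadicReduces (σ b) β) :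
    PadicReduces (σ (tateCurve a b).b₄) (α * β) := by
  rw [b₄_eq, map_mul]
  exact ha.mul hb

lemma reduces_b₆ (hb : PadicReduces (σ b) β) : PadicReduces (σ (tateCurve a b).b₆) (β ^ 2) := by
  rw [b₆_eq, map_pow]
  exact hb.pow 2

/-- A curve with good reduction at some place is an elliptic curve. -/
theorem isElliptic_of_reduction (ha : PadicReduces (σ a) α) (hb : PadicReduces (σ b) β)
    (h : ¬ (p : ℤ) ∣
    β ^ 3 * (-(α ^ 2 + 4 * β) ^ 2 - 8 * α ^ 3 - 27 * β + 9 * (α ^ 2 + 4 * β) * α)) :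
    (tateCurve a b).IsElliptic := by
  refine ⟨isUnit_iff_ne_zero.mpr fun h0 => ?_⟩
  have hA := (ha.pow 2).add ((PadicReduces.ofNat (p := p) 4).mul hb)
  have hΔ := (hb.pow 3).mul
    ((((hA.pow 2).neg.sub ((PadicReduces.ofNat (p := p) 8).mul (ha.pow 3))).sub
      ((PadicReduces.ofNat (p := p) 27).mul hb)).add
      (((PadicReduces.ofNat (p := p) 9).mul hA).mul ha))
  apply hΔ.ne_zero h
  rw [Δ_eq] at h0
  simpa [map_ofNat] using congrArg σ h0

/-- The quadratic character modulo `p` attached to a simple root modulo `p` of the `2`-division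
polynomial is trivial on sums of points that are divisible by `2`. -/
theorem prod_eq_one_of_sum_eq_two_smul [DecidableEq K]
    (ha : PadicReduces (σ a) α) (hb : PadicReduces (σ b) β)
    (hp2 : ¬ (p : ℤ) ∣ 2) {e : ℤ}
    (he : (p : ℤ) ∣ 4 * e ^ 3 + (α ^ 2 + 4 * β) * e ^ 2 + 2 * (α * β) * e + β ^ 2)
    (he' : ¬ (p : ℤ) ∣ 3 * 4 * e ^ 2 + 2 * (α ^ 2 + 4 * β) * e + 2 * (α * β))
    {ι : Type*} {x y : ι → K} (h : ∀ i, (tateCurve a b).toAffine.Nonsingular (x i) (y i))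
    {X : ι → ℤ} (hX : ∀ i, PadicReduces (σ (x i)) (X i)) {χ : ι → ℤ}
    (hχ : ∀ i, legendreSym p (X i - e) = χ i) (hχ0 : ∀ i, χ i ≠ 0) (S : Finset ι)
    (Q : (tateCurve a b).toAffine.Point)
    (hQ : ∑ i ∈ S, Point.some _ _ (h i) = (2 : ℤ) • Q) : ∏ i ∈ S, χ i = 1 := by
  have hXe : ∀ i, ((X i - e : ℤ) : ZMod p) ≠ 0 := fun i h0 =>
    hχ0 i (by rw [← hχ, legendreSym.eq_zero_iff]; exact h0)
  have hsq := isSquare_zmod_of_sum_eq_two_smul hp2 (tateCurve a b) σ (reduces_b₂ σ ha hb)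
    (reduces_b₄ σ ha hb) (reduces_b₆ σ hb) he he' h hX
    (fun i h0 => hXe i ((ZMod.intCast_zmod_eq_zero_iff_dvd _ p).mpr h0)) S Q hQ
  have hmul : ∏ i ∈ S, χ i = legendreSym p (∏ i ∈ S, (X i - e)) := by
    rw [← legendreSym.hom_apply, map_prod]
    exact Finset.prod_congr rfl fun i _ => (hχ i).symm
  rw [hmul, legendreSym.eq_one_iff _ (by
    rw [Int.cast_prod]; exact Finset.prod_ne_zero_iff.mpr fun i _ => hXe i)]
  exact hsq

/-- If the `2`-division polynomial has no root modulo `p`, then there is no `2`-torsion. -/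
theorem eq_zero_of_two_zsmul_eq_zero [DecidableEq K]
    (ha : PadicReduces (σ a) α) (hb : PadicReduces (σ b) β)
    (hp4 : ¬ (p : ℤ) ∣ 4)
    (hroot : ∀ r : ℕ, r < p → ¬ (p : ℤ) ∣
      4 * r ^ 3 + (α ^ 2 + 4 * β) * r ^ 2 + 2 * (α * β) * r + β ^ 2)
    {P : (tateCurve a b).toAffine.Point} (hP : (2 : ℤ) • P = 0) : P = 0 := by
  by_contra h0
  obtain ⟨x, y, -, -, -, hx⟩ := Point.eq_some_of_two_zsmul_eq_zero hP h0
  obtain ⟨r, hr, -, hrp⟩ := PadicReduces.exists_root_mod (PadicReduces.ofNat (p := p) 4)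
    (reduces_b₂ σ ha hb) ((PadicReduces.ofNat (p := p) 2).mul (reduces_b₄ σ ha hb))
    (reduces_b₆ (a := a) σ hb) hp4 (x := σ x) (by simpa [map_ofNat] using congrArg σ hx)
  exact hroot r hr hrp

/-- If the `2`-division polynomial has only one root modulo `p`, and this root is simple, then
there is at most one point of order `2`. -/
theorem eq_zero_or_eq_of_two_zsmul_eq_zero [DecidableEq K]
    (ha : PadicReduces (σ a) α) (hb : PadicReduces (σ b) β)
    (hp4 : ¬ (p : ℤ) ∣ 4) (s : ℕ)
    (hroot : ∀ r : ℕ, r < p → (p : ℤ) ∣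
      4 * r ^ 3 + (α ^ 2 + 4 * β) * r ^ 2 + 2 * (α * β) * r + β ^ 2 → r = s)
    (hs : ¬ (p : ℤ) ∣ 3 * 4 * s ^ 2 + 2 * (α ^ 2 + 4 * β) * s + 2 * (α * β))
    {P T : (tateCurve a b).toAffine.Point} (hT : (2 : ℤ) • T = 0) (hT0 : T ≠ 0)
    (hP : (2 : ℤ) • P = 0) : P = 0 ∨ P = T := by
  have h2 : (2 : K) ≠ 0 := fun h2 => by
    have := ((PadicReduces.ofNat (p := p) 2).mul (PadicReduces.ofNat (p := p) 2)).ne_zero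
      (by norm_num; exact hp4)
    apply this
    have h4 := congrArg σ h2
    rw [map_ofNat, map_zero] at h4
    rw [h4, mul_zero]
  obtain ⟨x₀, y₀, h₀, rfl, hy₀, hx₀⟩ := Point.eq_some_of_two_zsmul_eq_zero hT hT0
  refine Point.eq_some_of_two_zsmul_eq_zero_of_unique_root h2 h₀ hy₀ (fun x hx => ?_) hP
  refine σ.injective (PadicReduces.root_unique (PadicReduces.ofNat (p := p) 4)
    (reduces_b₂ σ ha hb) ((PadicReduces.ofNat (p := p) 2).mul (reduces_b₄ σ ha hb))
    (reduces_b₆ (a := a) σ hb) hp4 s hroot hs ?_ ?_)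
  · simpa [map_ofNat] using congrArg σ hx
  · simpa [map_ofNat] using congrArg σ hx₀

end Reduction

end tateCurve

/-! ### Reduction of rational and quadratic numbers -/

namespace PadicReduces

variable {p : ℕ} [Fact p.Prime] {K : Type*} [Field K] (σ : K →+* ℚ_[p])

/-- Reduction of the rational number `z = m / d`. -/
lemma ratCast_of_eq_div {z : ℚ} (m d s : ℤ) (hz : z = m / d) (hd : ¬ (p : ℤ) ∣ d)
    (h : (p : ℤ) ∣ m - s * d) : PadicReduces (Rat.castHom ℚ_[p] z) s := by
  rw [hz, map_div₀, map_intCast, map_intCast]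
  exact (intCast m).div (intCast d) s hd h

variable {σ} in
/-- Reduction of `z = (m w + n) / d`, where `w` reduces to `r`. -/
lemma map_of_eq_linear_div {w : K} {r : ℤ} (hw : PadicReduces (σ w) r) {z : K} (m n d s : ℤ)
    (hz : z = (m * w + n) / d) (hd : ¬ (p : ℤ) ∣ d) (h : (p : ℤ) ∣ m * r + n - s * d) :
    PadicReduces (σ z) s := by
  rw [hz, map_div₀, map_add, map_mul, map_intCast, map_intCast, map_intCast]
  exact (((intCast m).mul hw).add (intCast n)).div (intCast d) s hd h

end PadicReduces

/-! ### Quadratic fields and their embeddings into `ℚ_p` -/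

namespace QuadraticAlgebra

/-- `ω² = c₀ + c₁ ω` has no rational solution when the discriminant lies strictly between two
consecutive squares. -/
lemma sq_ne_of_disc_between {c₀ c₁ : ℤ} (m : ℕ) (h₁ : ((m * m : ℕ) : ℤ) < c₁ ^ 2 + 4 * c₀)
    (h₂ : c₁ ^ 2 + 4 * c₀ < (((m + 1) * (m + 1) : ℕ) : ℤ)) (r : ℚ) :
    r ^ 2 ≠ (c₀ : ℚ) + (c₁ : ℚ) * r := by
  intro h
  have hsq : IsSquare ((c₁ ^ 2 + 4 * c₀ : ℤ) : ℚ) :=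
    ⟨2 * r - c₁, by push_cast; linear_combination -4 * h⟩
  rw [Rat.isSquare_intCast_iff] at hsq
  obtain ⟨k, hk⟩ := hsq
  have hk' : c₁ ^ 2 + 4 * c₀ = ((k.natAbs * k.natAbs : ℕ) : ℤ) := by
    rw [hk, Nat.cast_mul, Int.natAbs_mul_self']
  rw [hk'] at h₁ h₂
  exact Nat.not_exists_sq (n := k.natAbs * k.natAbs) (by exact_mod_cast h₁) (by exact_mod_cast h₂)
    ⟨_, rfl⟩

variable {c₀ c₁ : ℚ}

section Field

variable [Fact (∀ r : ℚ, r ^ 2 ≠ c₀ + c₁ * r)]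

instance : CharZero (QuadraticAlgebra ℚ c₀ c₁) :=
  charZero_of_injective_algebraMap (algebraMap ℚ (QuadraticAlgebra ℚ c₀ c₁)).injective

instance : NumberField (QuadraticAlgebra ℚ c₀ c₁) where
  to_finiteDimensional := by
    convert! (inferInstance : Module.Finite ℚ (QuadraticAlgebra ℚ c₀ c₁))

lemma isQuadraticField : IsQuadraticField (QuadraticAlgebra ℚ c₀ c₁) := by
  rw [IsQuadraticField]
  convert! QuadraticAlgebra.finrank_eq_two c₀ c₁

end Field

lemma omega_sq : (omega : QuadraticAlgebra ℚ c₀ c₁) ^ 2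
    = algebraMap ℚ _ c₀ + algebraMap ℚ _ c₁ * omega := by
  ext <;> simp [pow_two]

/-- A simple root modulo `p` of the minimal polynomial of `ω` defines an embedding into `ℚ_p`. -/
theorem exists_embedding {n₀ n₁ : ℤ} (h₀ : c₀ = n₀) (h₁ : c₁ = n₁) (p : ℕ) [Fact p.Prime] (r : ℤ)
    (hr : (p : ℤ) ∣ r ^ 2 - n₁ * r - n₀) (hr' : ¬ (p : ℤ) ∣ 2 * r - n₁) :
    ∃ σ : QuadraticAlgebra ℚ c₀ c₁ →+* ℚ_[p], PadicReduces (σ omega) r := by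
  obtain ⟨e, he, her⟩ := PadicReduces.exists_root_of_simple_root_mod (p := p)
    (PadicReduces.intCast 0) (PadicReduces.intCast 1) (PadicReduces.intCast (-n₁))
    (PadicReduces.intCast (-n₀)) r (by convert hr using 1; ring)
    (by convert hr' using 2; ring)
  have hu : e * e = c₀ • (1 : ℚ_[p]) + c₁ • e := by
    rw [h₀, h₁, Algebra.smul_def, Algebra.smul_def]
    push_cast at he
    simp
    linear_combination he
  refine ⟨(QuadraticAlgebra.lift ⟨e, hu⟩ : QuadraticAlgebra ℚ c₀ c₁ →ₐ[ℚ] ℚ_[p]).toRingHom, ?_⟩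
  convert! her
  simp [QuadraticAlgebra.lift]

end QuadraticAlgebra

/-! ### Explicit torsion points -/

namespace tateCurve

open WeierstrassCurve.Affine

variable {K : Type} [Field K] [DecidableEq K] {a b : K}

lemma some_add_some_eq {x₁ y₁ x₂ y₂ x₃ y₃ : K} (h₁ : (tateCurve a b).toAffine.Nonsingular x₁ y₁)
    (h₂ : (tateCurve a b).toAffine.Nonsingular x₂ y₂)
    (h₃ : (tateCurve a b).toAffine.Nonsingular x₃ y₃) (ℓ : K) (hx : x₁ ≠ x₂)
    (hℓ : ℓ * (x₁ - x₂) = y₁ - y₂) (hx₃ : x₃ = ℓ ^ 2 + a * ℓ - b - x₁ - x₂)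
    (hy₃ : y₃ = -(ℓ * (x₃ - x₁) + y₁) - a * x₃ - b) :
    Point.some x₁ y₁ h₁ + Point.some x₂ y₂ h₂ = Point.some x₃ y₃ h₃ :=
  Point.some_add_some_eq h₁ h₂ h₃ ℓ hx hℓ hx₃ hy₃

lemma two_nsmul_some_eq {x₁ y₁ x₃ y₃ : K} (h₁ : (tateCurve a b).toAffine.Nonsingular x₁ y₁)
    (h₃ : (tateCurve a b).toAffine.Nonsingular x₃ y₃) (ℓ : K) (hy : 2 * y₁ + a * x₁ + b ≠ 0)
    (hℓ : ℓ * (2 * y₁ + a * x₁ + b) = 3 * x₁ ^ 2 + 2 * b * x₁ - a * y₁)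
    (hx₃ : x₃ = ℓ ^ 2 + a * ℓ - b - 2 * x₁)
    (hy₃ : y₃ = -(ℓ * (x₃ - x₁) + y₁) - a * x₃ - b) :
    2 • Point.some x₁ y₁ h₁ = Point.some x₃ y₃ h₃ :=
  Point.two_nsmul_some_eq h₁ h₃ ℓ hy
    (by rw [show (tateCurve a b).toAffine.a₄ = 0 from rfl, add_zero]; exact hℓ) hx₃ hy₃

lemma addOrderOf_eq_two {x y : K} (h : (tateCurve a b).toAffine.Nonsingular x y)
    (hy : 2 * y + a * x + b = 0) : addOrderOf (Point.some x y h) = 2 :=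
  addOrderOf_eq_prime (Point.two_nsmul_some_eq_zero h hy) (Point.some_ne_zero h)

/-- A point has order `3` when the `x`-coordinate of its double is its own `x`-coordinate. -/
lemma addOrderOf_eq_three {x y : K} (h : (tateCurve a b).toAffine.Nonsingular x y) (ℓ : K)
    (hy : 2 * y + a * x + b ≠ 0) (hℓ : ℓ * (2 * y + a * x + b) = 3 * x ^ 2 + 2 * b * x - a * y)
    (hx : x = ℓ ^ 2 + a * ℓ - b - 2 * x) : addOrderOf (Point.some x y h) = 3 := by
  have : Fact (Nat.Prime 3) := ⟨Nat.prime_three⟩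
  refine addOrderOf_eq_prime ?_ (Point.some_ne_zero h)
  have h2 : 2 • Point.some x y h = -Point.some x y h := by
    rw [Point.neg_some]
    refine two_nsmul_some_eq h _ ℓ hy hℓ hx ?_
    change -y - a * x - b = _
    ring
  rw [show 3 = 2 + 1 from rfl, succ_nsmul, h2, neg_add_cancel]

/-- On the curves with `a = b + 1` the point `(0, 0)` has order `5`: its double is `(-b, b²)`, and
its fourth multiple is `(0, -b)`, the opposite of `(0, 0)`. -/
lemma addOrderOf_zero_zero_eq_five [(tateCurve a b).IsElliptic] (hab : a = b + 1) (hb : b ≠ 0)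
    (h : (tateCurve a b).toAffine.Nonsingular 0 0) : addOrderOf (Point.some 0 0 h) = 5 := by
  have : Fact (Nat.Prime 5) := ⟨by norm_num⟩
  have h₂ : (tateCurve a b).toAffine.Nonsingular (-b) (b ^ 2) :=
    nonsingular (by rw [hab]; ring)
  have e₂ : 2 • Point.some 0 0 h = Point.some _ _ h₂ :=
    two_nsmul_some_eq h h₂ 0 (by simpa using hb) (by ring) (by ring) (by rw [hab]; ring)
  have e₄ : 2 • Point.some _ _ h₂ = -Point.some 0 0 h := by
    rw [Point.neg_some]
    refine two_nsmul_some_eq h₂ _ (-b) ?_ (by rw [hab]; ring) (by rw [hab]; ring) ?_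
    · rw [hab, show 2 * b ^ 2 + (b + 1) * -b + b = b ^ 2 by ring]
      exact pow_ne_zero 2 hb
    · change -0 - a * 0 - b = _
      rw [hab]; ring
  refine addOrderOf_eq_prime ?_ (Point.some_ne_zero h)
  rw [show 5 = 2 * 2 + 1 from rfl, succ_nsmul, mul_nsmul, e₂, e₄, neg_add_cancel]

end tateCurve

/-! ### From independent points to subgroups of the Mordell–Weil group -/

section

open WeierstrassCurve.Affine

/-- An embedding of a finite group and a family of independent points give the subgroup that
`MordellWeilContainsWith` asks for. The instance of decidable equality is arbitrary here, while the
definition uses the classical one. -/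
theorem mordellWeilContainsWith_of_independent {K : Type} [Field K] [DecidableEq K]
    {E : WeierstrassCurve K} {T : Type} [AddCommGroup T] [Finite T] (φ : T →+ E.toAffine.Point)
    (hφ : Function.Injective φ) {r : ℕ} {x y : Fin r → K}
    (h : ∀ i, E.toAffine.Nonsingular (x i) (y i))
    (hind : ∀ n : Fin r → ℤ, ∑ i, n i • Point.some _ _ (h i) = 0 → n = 0) :
    MordellWeilContainsWith E T x y := by
  obtain ⟨f, hf, hfi⟩ := exists_injective_prod_of_independent φ hφ _ hind
  unfold MordellWeilContainsWith
  convert (⟨f, hf, fun i => ⟨h i, hfi i⟩⟩ : ∃ f : T × (Fin r → ℤ) →+ E.toAffine.Point,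
    Function.Injective f ∧ ∀ i, ∃ h : E.toAffine.Nonsingular (x i) (y i),
      f (0, Pi.single i 1) = Point.some (x i) (y i) h)

end

/-! ### The curve with a point of order `15` -/

namespace tateCurve

open WeierstrassCurve.Affine

variable {K : Type} [Field K]

section Fifteen

variable {w : K}

/-- The discriminant and the `2`-division polynomial are controlled by the reduction
`y² + 6 x y + 5 y = x³ + 5 x²` modulo `11`, where the `2`-division polynomial has no root. The point
of order `15` is the sum of `(0, 0)`, of order `5`, and a point of order `3`; the independence
of the point of infinite order is seen modulo `31`. -/
theorem mordellWeilContainsWith_fifteen [CharZero K] (hw : w ^ 2 - w - 86 = 0)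
    (h₁₁ : ∀ _ : Fact (Nat.Prime 11), ∃ σ : K →+* ℚ_[11], PadicReduces (σ w) 5)
    (h₃₁ : ∀ _ : Fact (Nat.Prime 31), ∃ σ : K →+* ℚ_[31], PadicReduces (σ w) 17) :
    (tateCurve ((10 * w + 493) / 448) ((10 * w + 45) / 448)).IsElliptic ∧
      MordellWeilContainsWith (tateCurve ((10 * w + 493) / 448) ((10 * w + 45) / 448))
        (ZMod 15) ![(-w - 274) / 3584] ![(-2455 * w - 20382) / 200704] := by
  classical
  have : Fact (Nat.Prime 11) := ⟨by norm_num⟩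
  have : Fact (Nat.Prime 31) := ⟨by norm_num⟩
  obtain ⟨σ, hσ⟩ := h₁₁ inferInstance
  obtain ⟨τ, hτ⟩ := h₃₁ inferInstance
  have ha : PadicReduces (σ ((10 * w + 493) / 448)) 6 :=
    hσ.map_of_eq_linear_div 10 493 448 6 (by norm_num) (by norm_num) (by norm_num)
  have hb : PadicReduces (σ ((10 * w + 45) / 448)) 5 :=
    hσ.map_of_eq_linear_div 10 45 448 5 (by norm_num) (by norm_num) (by norm_num)
  have ha' : PadicReduces (τ ((10 * w + 493) / 448)) 23 :=
    hτ.map_of_eq_linear_div 10 493 448 23 (by norm_num) (by norm_num) (by norm_num)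
  have hb' : PadicReduces (τ ((10 * w + 45) / 448)) 22 :=
    hτ.map_of_eq_linear_div 10 45 448 22 (by norm_num) (by norm_num) (by norm_num)
  have hE := isElliptic_of_reduction σ ha hb (by norm_num)
  refine ⟨hE, ?_⟩
  have hO : (tateCurve ((10 * w + 493) / 448) ((10 * w + 45) / 448)).toAffine.Nonsingular 0 0 :=
    nonsingular (by ring)
  have hR : (tateCurve ((10 * w + 493) / 448) ((10 * w + 45) / 448)).toAffine.Nonsingular
      ((-10 * w - 45) / 588) ((-3875 * w - 14375) / 790272) :=
    nonsingular (by
      linear_combination (625 / 1927561216 * w + 758125 / 624529833984) * hw)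
  have hO5 := addOrderOf_zero_zero_eq_five (by ring)
    ((map_ne_zero σ).mp (hb.ne_zero (by norm_num))) hO
  have hR3 : addOrderOf (Point.some _ _ hR) = 3 := by
    refine addOrderOf_eq_three hR ((5 * w - 415) / 448) ?_
      (by linear_combination (-125 / 29503488 * w + 1825 / 44255232) * hw)
      (by linear_combination (-75 / 200704) * hw)
    have h : PadicReduces (σ (2 * ((-3875 * w - 14375) / 790272)
        + (10 * w + 493) / 448 * ((-10 * w - 45) / 588) + (10 * w + 45) / 448)) 5 :=
      hσ.map_of_eq_linear_div (-6550) (-41725) 790272 5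
        (by push_cast; linear_combination (-25 / 65856) * hw) (by norm_num) (by norm_num)
    exact (map_ne_zero σ).mp (h.ne_zero (by norm_num))
  obtain ⟨φ, hφ, -⟩ := exists_injective_zmod_of_addOrderOf_eq
    (Point.some _ _ hR + Point.some _ _ hO) 15 (by
      rw [(AddCommute.all _ _).addOrderOf_add_eq_mul_addOrderOf_of_coprime (by
        rw [hR3, hO5]; norm_num), hR3, hO5])
  have hP : ∀ i, (tateCurve ((10 * w + 493) / 448) ((10 * w + 45) / 448)).toAffine.Nonsingular
      (![(-w - 274) / 3584] i) (![(-2455 * w - 20382) / 200704] i) := by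
    intro i
    fin_cases i
    exact nonsingular (by
      dsimp
      linear_combination (23997 / 322256764928 * w - 15954907 / 161128382464) * hw)
  refine mordellWeilContainsWith_of_independent φ hφ hP fun n hn => ?_
  funext i
  refine eq_zero_of_sum_zsmul_eq_zero_of_independent_mod_two _ Finset.univ (fun Q hQ => ?_)
    (fun S Q hQ => ?_) n hn i (Finset.mem_univ i)
  · refine ⟨0, fun _ _ => rfl, ?_⟩
    rw [eq_zero_of_two_zsmul_eq_zero σ ha hb (by norm_num) (by decide) hQ]
    simp
  · -- The abscissa is congruent to `32` modulo `31`, and `32 - e = 17` is not a square.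
    have h := prod_eq_one_of_sum_eq_two_smul τ ha' hb' (by norm_num) (e := 15) (by norm_num)
      (by norm_num) hP (X := ![32]) (by
        intro i
        fin_cases i
        exact hτ.map_of_eq_linear_div (-1) (-274) 3584 32 (by norm_num; ring) (by norm_num)
          (by norm_num))
      (χ := ![-1]) (by intro i; fin_cases i; norm_num) (by decide) S Q hQ
    clear hQ
    -- The only nonempty subset has product `-1`.
    revert S
    decide

end Fifteen

end tateCurve

/-! ### The curve with a point of order `18` -/

namespace tateCurve

open WeierstrassCurve.Affine

variable {K : Type} [Field K]

section Eighteen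

variable {a b w : K}

/-- The point `O = (0, 0)` has order `9`: the double of `3 O` has the same `x`-coordinate as `3 O`,
so that `3 O` has order `3`. -/
lemma addOrderOf_zero_zero_eq_nine [CharZero K] [DecidableEq K] [(tateCurve a b).IsElliptic]
    (hw : w ^ 2 + 163 * w + 12 = 0)
    (ha : a = (25105 * w + 2071) / 216) (hb : b = (634768555 * w + 46752805) / 7776)
    (hb0 : b ≠ 0)
    (hd0 : (98836218875 * w + 7279575125) / 46656 ≠ 0)
    (hO : (tateCurve a b).toAffine.Nonsingular 0 0) : addOrderOf (Point.some 0 0 hO) = 9 := by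
  have h₂ : (tateCurve a b).toAffine.Nonsingular ((-634768555 * w - 46752805) / 7776)
      ((-2595194700604775 * w - 191143648426025) / 1679616) :=
    nonsingular (by
      rw [ha, hb]
      linear_combination (41356671290118654139802388125 / 2821109907456 * w
        + 3046039295358823512029481875 / 2821109907456) * hw)
  have h₃ : (tateCurve a b).toAffine.Nonsingular ((-25105 * w - 1855) / 216)
      ((-633864775 * w - 46686025) / 7776) :=
    nonsingular (by rw [ha, hb]; ring)
  have e₂ : 2 • Point.some 0 0 hO = Point.some _ _ h₂ :=
    two_nsmul_some_eq hO h₂ 0 (by simpa using hb0) (by ring) (by rw [hb]; ring)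
      (by rw [ha, hb]; linear_combination (-15935864573275 / 1679616) * hw)
  have e₃ : 3 • Point.some 0 0 hO = Point.some _ _ h₃ := by
    rw [succ_nsmul, e₂]
    refine some_add_some_eq h₂ hO h₃ ((-25105 * w - 1855) / 216) ?_
      (by linear_combination (15935864573275 / 1679616) * hw) (by rw [ha, hb]; ring)
      (by rw [ha, hb]; linear_combination (-15935864573275 / 1679616) * hw)
    rw [hb] at hb0
    contrapose! hb0
    linear_combination -hb0
  have h3 : addOrderOf (Point.some _ _ h₃) = 3 := by
    refine addOrderOf_eq_three h₃ ((-161 * w - 47) / 36) ?_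
      (by
        rw [ha, hb]
        linear_combination (101472025025 / 1679616 * w + 7476808775 / 1679616) * hw)
      (by rw [ha, hb]; linear_combination (3886379 / 7776) * hw)
    convert hd0 using 1
    rw [ha, hb]
    linear_combination (-630261025 / 46656) * hw
  have : Fact (Nat.Prime 3) := ⟨Nat.prime_three⟩
  refine addOrderOf_eq_prime_pow (p := 3) (n := 1) ?_ ?_
  · rw [pow_one, e₃]
    exact Point.some_ne_zero h₃
  · rw [show 3 ^ (1 + 1) = 3 * 3 from rfl, mul_nsmul, e₃, ← h3]
    exact addOrderOf_nsmul_eq_zero _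

/-- The discriminant and the `2`-division polynomial are controlled by the reduction
`y² + 6 x y + 7 y = x³ + 7 x²` modulo `13`, where the `2`-division polynomial has one root. The
point of order `18` is the sum of `(0, 0)`, of order `9`, and of the point of order `2`.
Independence modulo `2` is seen from quadratic characters modulo `13`, `19` and `71`. -/
theorem mordellWeilContainsWith_eighteen [CharZero K] (hw : w ^ 2 + 163 * w + 12 = 0)
    (ha : a = (25105 * w + 2071) / 216) (hb : b = (634768555 * w + 46752805) / 7776)
    (h₁₃ : ∀ _ : Fact (Nat.Prime 13), ∃ σ : K →+* ℚ_[13], PadicReduces (σ w) 9)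
    (h₁₉ : ∀ _ : Fact (Nat.Prime 19), ∃ σ : K →+* ℚ_[19], PadicReduces (σ w) 2)
    (h₇₁ : ∀ _ : Fact (Nat.Prime 71), ∃ σ : K →+* ℚ_[71], PadicReduces (σ w) 45) :
    (tateCurve a b).IsElliptic ∧ MordellWeilContainsWith (tateCurve a b) (ZMod 18)
      ![(3673 * w + 223) / 486, (-112579 * w - 8293) / 6]
      ![(150110959 * w + 11056609) / 8748, (-3011095399 * w - 221775913) / 288] := by
  classical
  have : Fact (Nat.Prime 13) := ⟨by norm_num⟩
  have : Fact (Nat.Prime 19) := ⟨by norm_num⟩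
  have : Fact (Nat.Prime 71) := ⟨by norm_num⟩
  obtain ⟨σ, hσ⟩ := h₁₃ inferInstance
  obtain ⟨τ, hτ⟩ := h₁₉ inferInstance
  obtain ⟨υ, hυ⟩ := h₇₁ inferInstance
  have haσ : PadicReduces (σ a) 6 :=
    hσ.map_of_eq_linear_div 25105 2071 216 6 (by rw [ha]; norm_num) (by norm_num) (by norm_num)
  have hbσ : PadicReduces (σ b) 7 :=
    hσ.map_of_eq_linear_div 634768555 46752805 7776 7 (by rw [hb]; norm_num) (by norm_num)
      (by norm_num)
  have hE := isElliptic_of_reduction σ haσ hbσ (by norm_num)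
  refine ⟨hE, ?_⟩
  have hO : (tateCurve a b).toAffine.Nonsingular 0 0 := nonsingular (by ring)
  have hT : (tateCurve a b).toAffine.Nonsingular ((580781 * w + 131) / 186624)
      ((-915223633511 * w - 67400728361) / 80621568) :=
    nonsingular (by
      rw [ha, hb]
      linear_combination (-31827723596491994041171 / 6499837226778624 * w
        - 2344045100923417777021 / 6499837226778624) * hw)
  have ht : (tateCurve a b).toAffine.Nonsingular ((-10566505 * w - 778255) / 18)
      ((-4293342536275 * w - 316217182525) / 324) :=
    nonsingular (by
      rw [ha, hb]
      linear_combination (2716592303006970014828875 / 2519424 * w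
        + 200084935430232019685125 / 2519424) * hw)
  have hO9 : addOrderOf (Point.some 0 0 hO) = 9 := by
    refine addOrderOf_zero_zero_eq_nine hw ha hb
      ((map_ne_zero σ).mp (hbσ.ne_zero (by norm_num))) ?_ hO
    have h := hσ.map_of_eq_linear_div (z := (98836218875 * w + 7279575125) / 46656)
      98836218875 7279575125 46656 12 (by norm_num) (by norm_num) (by norm_num)
    exact (map_ne_zero σ).mp (h.ne_zero (by norm_num))
  have hT2 : addOrderOf (Point.some _ _ hT) = 2 :=
    addOrderOf_eq_two hT (by rw [ha, hb]; linear_combination (14580507005 / 40310784) * hw)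
  have hTO : Point.some _ _ hT + Point.some _ _ hO = Point.some _ _ ht := by
    refine some_add_some_eq hT hO ht ((9671 * w + 521) / 432) ?_
      (by linear_combination (5616733051 / 80621568) * hw)
      (by rw [ha, hb]; linear_combination (-579109151 / 186624) * hw)
      (by rw [ha, hb]; linear_combination (-6560180177796091 / 80621568) * hw)
    have h := hσ.map_of_eq_linear_div (z := (580781 * w + 131) / 186624) 580781 131 186624 9
      (by norm_num) (by norm_num) (by norm_num)
    exact (map_ne_zero σ).mp (h.ne_zero (by norm_num))
  have ht18 := addOrderOf_add_eq_two_mul hT2 hO9 (by decide)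
  have ht9 := nsmul_add_eq_left_of_addOrderOf hT2 hO9 (by decide)
  rw [hTO] at ht18 ht9
  obtain ⟨φ, hφ, -⟩ := exists_injective_zmod_of_addOrderOf_eq _ 18 ht18
  have hP : ∀ i : Fin 3, (tateCurve a b).toAffine.Nonsingular
      (![(3673 * w + 223) / 486, (-112579 * w - 8293) / 6, (-10566505 * w - 778255) / 18] i)
      (![(150110959 * w + 11056609) / 8748, (-3011095399 * w - 221775913) / 288,
        (-4293342536275 * w - 316217182525) / 324] i) := by
    intro i
    fin_cases i
    · exact nonsingular (by
        rw [ha, hb]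
        dsimp
        linear_combination (6373084121500801 / 612220032 * w
          + 469413778071151 / 612220032) * hw)
    · exact nonsingular (by
        rw [ha, hb]
        dsimp
        linear_combination (747118297924448771 / 1119744 * w
          + 55027434945801677 / 1119744) * hw)
    · exact ht
  refine mordellWeilContainsWith_of_independent φ hφ
    (x := ![(3673 * w + 223) / 486, (-112579 * w - 8293) / 6])
    (y := ![(150110959 * w + 11056609) / 8748, (-3011095399 * w - 221775913) / 288])
    (Fin.forall_fin_two.mpr ⟨hP 0, hP 1⟩) fun n hn => ?_
  refine eq_zero_of_sum_zsmul_castSucc_eq_zero (fun i => Point.some _ _ (hP i)) (fun Q hQ => ?_)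
    (fun S Q hQ => ?_) n (by rw [Fin.sum_univ_two] at hn ⊢; exact hn)
  · rcases eq_zero_or_eq_of_two_zsmul_eq_zero σ haσ hbσ (by norm_num) 9 (by decide) (by norm_num)
      (T := Point.some _ _ hT) (by rw [← addOrderOf_dvd_iff_zsmul_eq_zero, hT2]; norm_num)
      (Point.some_ne_zero hT) hQ with rfl | rfl
    · exact ⟨0, (zero_zsmul _).symm⟩
    · exact ⟨9, ht9.symm⟩
  · -- `X` lists residues of the abscissas, and `χ` the Legendre symbols of `X i - e`.
    have h13 := prod_eq_one_of_sum_eq_two_smul σ haσ hbσ (by norm_num) (e := 9) (by norm_num)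
      (by norm_num) hP (X := ![13, 19, 17]) (by
        intro i
        fin_cases i
        · exact hσ.map_of_eq_linear_div 3673 223 486 13 (by norm_num) (by norm_num) (by norm_num)
        · exact hσ.map_of_eq_linear_div (-112579) (-8293) 6 19 (by norm_num; ring) (by norm_num)
            (by norm_num)
        · exact hσ.map_of_eq_linear_div (-10566505) (-778255) 18 17 (by norm_num; ring)
            (by norm_num) (by norm_num))
      (χ := ![1, 1, -1]) (by intro i; fin_cases i <;> norm_num) (by decide) S Q hQ
    have h19 := prod_eq_one_of_sum_eq_two_smul τ (α := 18) (β := 6)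
      (hτ.map_of_eq_linear_div 25105 2071 216 _ (by rw [ha]; norm_num) (by norm_num) (by norm_num))
      (hτ.map_of_eq_linear_div 634768555 46752805 7776 _ (by rw [hb]; norm_num) (by norm_num)
        (by norm_num)) (by norm_num) (e := 15) (by norm_num)
      (by norm_num) hP (X := ![30, 32, 28]) (by
        intro i
        fin_cases i
        · exact hτ.map_of_eq_linear_div 3673 223 486 30 (by norm_num) (by norm_num) (by norm_num)
        · exact hτ.map_of_eq_linear_div (-112579) (-8293) 6 32 (by norm_num; ring) (by norm_num)
            (by norm_num)
        · exact hτ.map_of_eq_linear_div (-10566505) (-778255) 18 28 (by norm_num; ring)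
            (by norm_num) (by norm_num))
      (χ := ![-1, 1, -1]) (by intro i; fin_cases i <;> norm_num) (by decide) S Q hQ
    have h71 := prod_eq_one_of_sum_eq_two_smul υ (α := 66) (β := 45)
      (hυ.map_of_eq_linear_div 25105 2071 216 _ (by rw [ha]; norm_num) (by norm_num) (by norm_num))
      (hυ.map_of_eq_linear_div 634768555 46752805 7776 _ (by rw [hb]; norm_num) (by norm_num)
        (by norm_num)) (by norm_num) (e := 17) (by norm_num)
      (by norm_num) hP (X := ![51, 51, 79]) (by
        intro i
        fin_cases i
        · exact hυ.map_of_eq_linear_div 3673 223 486 51 (by norm_num) (by norm_num) (by norm_num)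
        · exact hυ.map_of_eq_linear_div (-112579) (-8293) 6 51 (by norm_num; ring) (by norm_num)
            (by norm_num)
        · exact hυ.map_of_eq_linear_div (-10566505) (-778255) 18 79 (by norm_num; ring)
            (by norm_num) (by norm_num))
      (χ := ![-1, -1, -1]) (by intro i; fin_cases i <;> norm_num) (by decide) S Q hQ
    clear hQ
    -- The three vectors of signs form a basis of `{±1}³`, so only the empty product is trivial.
    revert S
    decide

end Eighteen

end tateCurve

/-! ### Curves with coefficients in `ℚ` over an extension -/

namespace tateCurve

open WeierstrassCurve.Affine

/-- Independent rational points, a rational point `t` of order `2 m` and a point of order `2` over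
`K` whose abscissa is not rational give a subgroup `ℤ/2 × ℤ/(2m) × ℤ ^ r` of `E(K)`. -/
theorem mordellWeilContainsWith_of_rational {K : Type} [Field K] [CharZero K] {a b : ℚ} {a' b' : K}
    (ha : (a : K) = a') (hb : (b : K) = b') {t : (tateCurve a b).toAffine.Point} (m : ℕ) [NeZero m]
    (ht : addOrderOf t = 2 * m) {xT yT : ℚ} (hT : (tateCurve a b).toAffine.Nonsingular xT yT)
    (htT : m • t = Point.some xT yT hT) {x₂ y₂ : K}
    (h₂ : (tateCurve a' b').toAffine.Nonsingular x₂ y₂) (hy₂ : 2 * y₂ + a' * x₂ + b' = 0)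
    (hx₂ : ∀ q : ℚ, (q : K) ≠ x₂) {r : ℕ} {x y : Fin r → ℚ} {x' y' : Fin r → K}
    (h : ∀ i, (tateCurve a b).toAffine.Nonsingular (x i) (y i))
    (hind : ∀ n : Fin r → ℤ, ∑ i, n i • Point.some _ _ (h i) = 0 → n = 0)
    (hx : ∀ i, (x i : K) = x' i) (hy : ∀ i, (y i : K) = y' i) :
    MordellWeilContainsWith (tateCurve a' b') (ZMod 2 × ZMod (2 * m)) x' y' := by
  classical
  have hV : (tateCurve a b).toAffine.map (Rat.castHom K) = (tateCurve a' b').toAffine :=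
    map_eq (Rat.castHom K) ha hb
  obtain ⟨hT', eT⟩ := Point.mapHomOfEq_some (Rat.castHom K) hV hT rfl rfl
  choose h' e' using fun i => Point.mapHomOfEq_some (Rat.castHom K) hV (h i) (hx i) (hy i)
  have hinj := Point.mapHomOfEq_injective (Rat.castHom K) hV
  obtain ⟨φ, hφ⟩ := exists_injective_zmod_two_prod_zmod (Point.some _ _ h₂)
    (Point.mapHomOfEq (Rat.castHom K) hV t) m
    (by rw [addOrderOf_injective _ hinj, ht]) (addOrderOf_eq_two h₂ hy₂) (by
      rw [← map_nsmul, htT, eT, ne_eq, Point.some.injEq]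
      exact fun h0 => hx₂ xT h0.1.symm)
  refine mordellWeilContainsWith_of_independent φ hφ h' fun n hn => hind n (hinj ?_)
  rw [map_zero, map_sum, ← hn]
  exact Finset.sum_congr rfl fun i _ => by rw [map_zsmul, e']

end tateCurve

/-! ### The curve with torsion `ℤ/2 × ℤ/10` -/

namespace tateCurve

namespace TwoTen

open WeierstrassCurve.Affine

/-- The numerators of the abscissas of four independent points and, last, of a point of order
`10`. -/
def num : Fin 5 → ℤ :=
  ![-76249664,
    1378903694270734,
    -317897024,
    -10158696384,
    -1089348928]

/-- The denominators of the abscissas whose numerators are `num`. -/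
def den : Fin 5 → ℤ :=
  ![9062625,
    47323818070815,
    55559933,
    631362875,
    78953589]

/-- The ordinates of the points with abscissas `num i / den i`. -/
def ordinate : Fin 5 → ℚ :=
  ![-3294239461376 / 55961709375,
    -233856747339051186962702 / 6331823076742017702705,
    -54763043233792 / 3408435209751,
    -66880771114752 / 779733150625,
    -1312700317405696 / 14530697473149]

variable {a b : ℚ}

/-- Reduction of the coefficients at the primes that do not divide their denominators. -/
lemma reduces (ha : a = -1001929453 / 87419475)
    (hb : b = -1089348928 / 87419475) (p : ℕ) [Fact p.Prime]
    (α β : ℤ) (hp : ¬ (p : ℤ) ∣ 87419475 ∧ ¬ (p : ℤ) ∣ 87419475)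
    (hα : (p : ℤ) ∣ -1001929453 - α * 87419475)
    (hβ : (p : ℤ) ∣ -1089348928 - β * 87419475) :
    PadicReduces (Rat.castHom ℚ_[p] a) α ∧ PadicReduces (Rat.castHom ℚ_[p] b) β :=
  ⟨.ratCast_of_eq_div _ _ _ (by rw [ha]; norm_num) hp.1 hα,
    .ratCast_of_eq_div _ _ _ (by rw [hb]; norm_num) hp.2 hβ⟩

lemma reduces_mod_seven (ha : a = -1001929453 / 87419475)
    (hb : b = -1089348928 / 87419475) [Fact (Nat.Prime 7)] :
    PadicReduces (Rat.castHom ℚ_[7] a) 0 ∧ PadicReduces (Rat.castHom ℚ_[7] b) 6 :=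
  reduces ha hb 7 0 6 (by norm_num) (by norm_num) (by norm_num)

lemma isElliptic (ha : a = -1001929453 / 87419475)
    (hb : b = -1089348928 / 87419475) :
    (tateCurve a b).IsElliptic :=
  have : Fact (Nat.Prime 7) := ⟨by norm_num⟩
  isElliptic_of_reduction _ (reduces_mod_seven ha hb).1 (reduces_mod_seven ha hb).2 (by norm_num)

lemma nonsingular_ordinate (ha : a = -1001929453 / 87419475)
    (hb : b = -1089348928 / 87419475) (i : Fin 5) :
    (tateCurve a b).toAffine.Nonsingular (num i / den i : ℚ) (ordinate i) := by
  have := isElliptic ha hb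
  apply nonsingular
  rw [ha, hb]
  fin_cases i <;> norm_num [num, den, ordinate]

lemma nonsingular_two_torsion (ha : a = -1001929453 / 87419475)
    (hb : b = -1089348928 / 87419475) :
    (tateCurve a b).toAffine.Nonsingular (-817216 / 225625) (-667841990656 / 45976734375) := by
  have := isElliptic ha hb
  apply nonsingular
  rw [ha, hb]
  norm_num

lemma addOrderOf_two_torsion (ha : a = -1001929453 / 87419475)
    (hb : b = -1089348928 / 87419475) :
    addOrderOf (Point.some _ _ (nonsingular_two_torsion ha hb)) = 2 :=
  addOrderOf_eq_two _ (by rw [ha, hb]; norm_num)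

/-- The point of order `10` is the sum of the point of order `2` and of `(0, 0)`, of order `5`. -/
lemma addOrderOf_last_and_nsmul_last (ha : a = -1001929453 / 87419475)
    (hb : b = -1089348928 / 87419475) :
    addOrderOf (Point.some _ _ (nonsingular_ordinate ha hb (Fin.last 4))) = 2 * 5 ∧
      5 • Point.some _ _ (nonsingular_ordinate ha hb (Fin.last 4)) =
        Point.some _ _ (nonsingular_two_torsion ha hb) := by
  have := isElliptic ha hb
  have hO : (tateCurve a b).toAffine.Nonsingular 0 0 := nonsingular (by ring)
  have hO5 := addOrderOf_zero_zero_eq_five (by rw [ha, hb]; norm_num) (by rw [hb]; norm_num) hO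
  have hTO : Point.some _ _ (nonsingular_two_torsion ha hb) + Point.some _ _ hO =
      Point.some _ _ (nonsingular_ordinate ha hb (Fin.last 4)) := by
    apply some_add_some_eq _ _ _ (817216 / 203775) <;>
      norm_num [ha, hb, num, den, ordinate, Fin.last]
  have hT2 := addOrderOf_two_torsion ha hb
  rw [← hTO]
  exact ⟨addOrderOf_add_eq_two_mul hT2 hO5 (by decide),
    nsmul_add_eq_left_of_addOrderOf hT2 hO5 (by decide)⟩

lemma nsmul_eq_two_torsion (ha : a = -1001929453 / 87419475)
    (hb : b = -1089348928 / 87419475) :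
    5 • Point.some _ _ (nonsingular_ordinate ha hb (Fin.last 4)) =
      Point.some _ _ (nonsingular_two_torsion ha hb) :=
  (addOrderOf_last_and_nsmul_last ha hb).2

/-- Independence modulo `2` of the five points, seen from quadratic characters modulo `7`, `17` (two
of them), `23` and `29`. -/
lemma eq_empty_of_sum_eq_two_smul (ha : a = -1001929453 / 87419475)
    (hb : b = -1089348928 / 87419475)
    (S : Finset (Fin 5)) (Q : (tateCurve a b).toAffine.Point)
    (hQ : ∑ i ∈ S, Point.some _ _ (nonsingular_ordinate ha hb i) = (2 : ℤ) • Q) : S = ∅ := by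
  -- `hXp` lists the residues modulo `p` of the abscissas.
  have : Fact (Nat.Prime 7) := ⟨by norm_num⟩
  have hd7 : ∀ i, ¬ ((7 : ℕ) : ℤ) ∣ den i := by decide
  have hr7 := reduces ha hb 7 0 6 (by norm_num) (by norm_num) (by norm_num)
  have hX7 : ∀ i, PadicReduces (Rat.castHom ℚ_[7] (num i / den i)) (![4, 5, 5, 1, 4] i) :=
    fun i => .ratCast_of_eq_div _ _ _ rfl (hd7 i) (by revert i; decide)
  have : Fact (Nat.Prime 17) := ⟨by norm_num⟩
  have hd17 : ∀ i, ¬ ((17 : ℕ) : ℤ) ∣ den i := by decide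
  have hr17 := reduces ha hb 17 6 5 (by norm_num) (by norm_num) (by norm_num)
  have hX17 : ∀ i, PadicReduces (Rat.castHom ℚ_[17] (num i / den i)) (![13, 6, 3, 10, 3] i) :=
    fun i => .ratCast_of_eq_div _ _ _ rfl (hd17 i) (by revert i; decide)
  have : Fact (Nat.Prime 23) := ⟨by norm_num⟩
  have hd23 : ∀ i, ¬ ((23 : ℕ) : ℤ) ∣ den i := by decide
  have hr23 := reduces ha hb 23 12 11 (by norm_num) (by norm_num) (by norm_num)
  have hX23 : ∀ i, PadicReduces (Rat.castHom ℚ_[23] (num i / den i)) (![7, 7, 1, 16, 11] i) :=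
    fun i => .ratCast_of_eq_div _ _ _ rfl (hd23 i) (by revert i; decide)
  have : Fact (Nat.Prime 29) := ⟨by norm_num⟩
  have hd29 : ∀ i, ¬ ((29 : ℕ) : ℤ) ∣ den i := by decide
  have hr29 := reduces ha hb 29 13 12 (by norm_num) (by norm_num) (by norm_num)
  have hX29 : ∀ i, PadicReduces (Rat.castHom ℚ_[29] (num i / den i)) (![4, 26, 18, 14, 7] i) :=
    fun i => .ratCast_of_eq_div _ _ _ rfl (hd29 i) (by revert i; decide)
  have h7_6 := prod_eq_one_of_sum_eq_two_smul _ hr7.1 hr7.2 (by norm_num) (e := 6)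
    (by norm_num) (by norm_num) (nonsingular_ordinate ha hb) hX7 (χ := ![-1, -1, -1, 1, -1])
    (by intro i; fin_cases i <;> norm_num) (by decide) S Q hQ
  have h17_8 := prod_eq_one_of_sum_eq_two_smul _ hr17.1 hr17.2 (by norm_num) (e := 8)
    (by norm_num) (by norm_num) (nonsingular_ordinate ha hb) hX17 (χ := ![-1, 1, -1, 1, -1])
    (by intro i; fin_cases i <;> norm_num) (by decide) S Q hQ
  have h17_16 := prod_eq_one_of_sum_eq_two_smul _ hr17.1 hr17.2 (by norm_num) (e := 16)
    (by norm_num) (by norm_num) (nonsingular_ordinate ha hb) hX17 (χ := ![-1, -1, 1, -1, 1])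
    (by intro i; fin_cases i <;> norm_num) (by decide) S Q hQ
  have h23_19 := prod_eq_one_of_sum_eq_two_smul _ hr23.1 hr23.2 (by norm_num) (e := 19)
    (by norm_num) (by norm_num) (nonsingular_ordinate ha hb) hX23 (χ := ![-1, -1, -1, -1, -1])
    (by intro i; fin_cases i <;> norm_num) (by decide) S Q hQ
  have h29_22 := prod_eq_one_of_sum_eq_two_smul _ hr29.1 hr29.2 (by norm_num) (e := 22)
    (by norm_num) (by norm_num) (nonsingular_ordinate ha hb) hX29 (χ := ![-1, 1, 1, -1, -1])
    (by intro i; fin_cases i <;> norm_num) (by decide) S Q hQ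
  clear hQ
  -- The five vectors of signs form a basis of `{±1}⁵`, so that only the empty product is trivial.
  revert S
  decide +kernel

theorem eq_zero_of_sum_zsmul_eq_zero (ha : a = -1001929453 / 87419475)
    (hb : b = -1089348928 / 87419475)
    (n : Fin 4 → ℤ)
    (hn : ∑ i, n i • Point.some _ _ (nonsingular_ordinate ha hb (Fin.castSucc i)) = 0) : n = 0 := by
  have : Fact (Nat.Prime 7) := ⟨by norm_num⟩
  refine eq_zero_of_sum_zsmul_castSucc_eq_zero
    (fun i => Point.some _ _ (nonsingular_ordinate ha hb i)) (fun Q hQ => ?_)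
    (eq_empty_of_sum_eq_two_smul ha hb) n hn
  have hT := addOrderOf_two_torsion ha hb
  rcases eq_zero_or_eq_of_two_zsmul_eq_zero _ (reduces_mod_seven ha hb).1
    (reduces_mod_seven ha hb).2 (by norm_num) 6 (by decide) (by norm_num)
    (T := Point.some _ _ (nonsingular_two_torsion ha hb))
    (by rw [← addOrderOf_dvd_iff_zsmul_eq_zero, hT]; norm_num) (Point.some_ne_zero _) hQ
    with rfl | rfl
  · exact ⟨0, (zero_zsmul _).symm⟩
  · exact ⟨5, (nsmul_eq_two_torsion ha hb).symm.trans (natCast_zsmul _ _).symm⟩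

/-- The quadratic field enters only through the points of order `2`, which become rational over it;
the other points are rational over `ℚ`. -/
theorem mordellWeilContainsWith_two_ten {K : Type} [Field K] [CharZero K] {w : K}
    (hw : w ^ 2 = 55325286553) (hwq : ∀ q : ℚ, (q : K) ≠ w) :
    (tateCurve (-1001929453 / 87419475 : K) (-1089348928 / 87419475)).IsElliptic ∧
      MordellWeilContainsWith
        (tateCurve (-1001929453 / 87419475 : K) (-1089348928 / 87419475))
        (ZMod 2 × ZMod 10)
        ![-76249664 / 9062625, 1378903694270734 / 47323818070815,
          -317897024 / 55559933, -10158696384 / 631362875]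
        ![-3294239461376 / 55961709375,
          -233856747339051186962702 / 6331823076742017702705,
          -54763043233792 / 3408435209751, -66880771114752 / 779733150625] := by
  have ha : ((-1001929453 / 87419475 : ℚ) : K) = -1001929453 / 87419475 := by norm_num
  have hb : ((-1089348928 / 87419475 : ℚ) : K) = -1089348928 / 87419475 := by norm_num
  have hE : (tateCurve (-1001929453 / 87419475 : K) (-1089348928 / 87419475)).IsElliptic := by
    have := isElliptic rfl rfl
    rw [← map_eq (Rat.castHom K) ha hb]
    infer_instance
  refine ⟨hE, ?_⟩
  have h₂ : (tateCurve (-1001929453 / 87419475 : K) (-1089348928 / 87419475)).toAffine.Nonsingular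
      ((-8884445 * w - 2270233341073) / 270968717448)
      ((-1780317423811717 * w - 395886833546023925465) / 9475177208290999920) :=
    nonsingular (by
      linear_combination
        (918094234169809733453959011097 /
            179557966257034453766224655346880012800
          + 701279121865610421125 /
            19895619529865313436700792836219392 * w) * hw)
  have hx₂ : ∀ q : ℚ, (q : K) ≠
      (-8884445 * w - 2270233341073) / 270968717448 := fun q hq =>
    hwq (-(270968717448 * q + 2270233341073) / 8884445) (by push_cast; rw [hq]; ring)
  exact mordellWeilContainsWith_of_rational ha hb 5
    (addOrderOf_last_and_nsmul_last rfl rfl).1 _ (nsmul_eq_two_torsion rfl rfl) h₂ (by ring) hx₂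
    (fun i => nonsingular_ordinate rfl rfl (Fin.castSucc i)) (eq_zero_of_sum_zsmul_eq_zero rfl rfl)
    (by intro i; fin_cases i <;> norm_num [num, den])
    (by intro i; fin_cases i <;> norm_num [ordinate])

end TwoTen

end tateCurve

/-! ### The curve with torsion `ℤ/2 × ℤ/12` -/

namespace tateCurve

namespace TwoTwelve

open WeierstrassCurve.Affine

/-- The numerators of the abscissas of four independent points and, last, of the point
`(0, 0)` of order `12`. -/
def num : Fin 5 → ℤ :=
  ![54010378448671575276585954,
    92553828872677743601547118658292142773192310448592230363399710,
    -170938215590440827974952437797011888579983970287997844757922825018743266050,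
    2538005011619461286353043190728378082752497535301635775793905474038095417170066076954920261390,
    0]

/-- The denominators of the abscissas whose numerators are `num`. -/
def den : Fin 5 → ℤ :=
  ![1379711932681965186567025,
    2414580348566358339758874139450073451670033745287449769463641,
    5758769293044900307036808476964443582715412765961112216248909987786700147,
    55979526888367192549303316099941404691504251272209821677348939021186936420149893988965156139,
    1]

/-- The ordinates of the points with abscissas `num i / den i`. -/
def ordinate : Fin 5 → ℚ :=
  ![-2172747643886411669143388885254642236 / 2732926408015497607398293158018375,
    -140560410352977372358769811529588985595058067984223848234702500806749908169100187355840603238300 /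
      183847857297082410410046471422016598050817472311442096177141929387101690393535202142869862989,
    1654776334704117489555377824747616891249238314359125428561080242389023002935985140588728093949403578505387183765000 /
      1466893781535012890325661547598169019494248220515884268135085539943376130687604960210653503765208109571914396129,
    -1855963024855860724362423949749605995253664950357534075992565901454211661159587258114272799513361056588981495387866707203867706953129426024460 /
      1825663092716655004800517173214718474843250020411572419851423460530685161699002646219466696830875459025888490024245137769782233961254366931,
    0]

variable {a b : ℚ}

/-- Reduction of the coefficients at the primes that do not divide their denominators. -/
lemma reduces (ha : a = 1024873209359 / 27734204981)
    (hb : b = -543206429719981170 / 2187369012646489) (p : ℕ) [Fact p.Prime]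
    (α β : ℤ) (hp : ¬ (p : ℤ) ∣ 27734204981 ∧ ¬ (p : ℤ) ∣ 2187369012646489)
    (hα : (p : ℤ) ∣ 1024873209359 - α * 27734204981)
    (hβ : (p : ℤ) ∣ -543206429719981170 - β * 2187369012646489) :
    PadicReduces (Rat.castHom ℚ_[p] a) α ∧ PadicReduces (Rat.castHom ℚ_[p] b) β :=
  ⟨.ratCast_of_eq_div _ _ _ (by rw [ha]; norm_num) hp.1 hα,
    .ratCast_of_eq_div _ _ _ (by rw [hb]; norm_num) hp.2 hβ⟩

lemma reduces_mod_thirty_one (ha : a = 1024873209359 / 27734204981)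
    (hb : b = -543206429719981170 / 2187369012646489) [Fact (Nat.Prime 31)] :
    PadicReduces (Rat.castHom ℚ_[31] a) 23 ∧ PadicReduces (Rat.castHom ℚ_[31] b) 16 :=
  reduces ha hb 31 23 16 (by norm_num) (by norm_num) (by norm_num)

lemma isElliptic (ha : a = 1024873209359 / 27734204981)
    (hb : b = -543206429719981170 / 2187369012646489) :
    (tateCurve a b).IsElliptic :=
  have : Fact (Nat.Prime 31) := ⟨by norm_num⟩
  isElliptic_of_reduction _ (reduces_mod_thirty_one ha hb).1 (reduces_mod_thirty_one ha hb).2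
    (by norm_num)

lemma nonsingular_ordinate (ha : a = 1024873209359 / 27734204981)
    (hb : b = -543206429719981170 / 2187369012646489) (i : Fin 5) :
    (tateCurve a b).toAffine.Nonsingular (num i / den i : ℚ) (ordinate i) := by
  have := isElliptic ha hb
  apply nonsingular
  rw [ha, hb]
  fin_cases i <;> norm_num [num, den, ordinate]

lemma nonsingular_two_torsion (ha : a = 1024873209359 / 27734204981)
    (hb : b = -543206429719981170 / 2187369012646489) :
    (tateCurve a b).toAffine.Nonsingular (1373469703 / 41958308)
      (-1886419025058908209 / 3924722815271272) := by
  have := isElliptic ha hb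
  apply nonsingular
  rw [ha, hb]
  norm_num

lemma addOrderOf_two_torsion (ha : a = 1024873209359 / 27734204981)
    (hb : b = -543206429719981170 / 2187369012646489) :
    addOrderOf (Point.some _ _ (nonsingular_two_torsion ha hb)) = 2 :=
  addOrderOf_eq_two _ (by rw [ha, hb]; norm_num)

/-- The multiples `2 t`, `3 t` and `6 t` of `t = (0, 0)`; the last is the point of order `2`. -/
lemma nsmul_zero_zero (ha : a = 1024873209359 / 27734204981)
    (hb : b = -543206429719981170 / 2187369012646489)
    (hO : (tateCurve a b).toAffine.Nonsingular 0 0) :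
    (∃ (y : ℚ) (h : _), 2 • Point.some 0 0 hO = Point.some (-b) y h) ∧
      6 • Point.some 0 0 hO = Point.some _ _ (nonsingular_two_torsion ha hb) := by
  have := isElliptic ha hb
  have h₂ : (tateCurve a b).toAffine.Nonsingular (-b) (a * b - b) := nonsingular (by ring)
  have h₃ : (tateCurve a b).toAffine.Nonsingular (-997139004378 / 27734204981)
      (621849785856269652 / 2187369012646489) :=
    nonsingular (by rw [ha, hb]; norm_num)
  have e₂ : 2 • Point.some 0 0 hO = Point.some _ _ h₂ := by
    apply two_nsmul_some_eq hO h₂ 0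
    · rw [hb]; norm_num
    all_goals ring
  have e₃ : 3 • Point.some 0 0 hO = Point.some _ _ h₃ := by
    rw [succ_nsmul, e₂]
    apply some_add_some_eq h₂ hO h₃ (-997139004378 / 27734204981) <;> rw [hb] <;> norm_num [ha]
  refine ⟨⟨_, h₂, e₂⟩, ?_⟩
  rw [show 6 = 3 * 2 from rfl, mul_nsmul, e₃]
  apply two_nsmul_some_eq h₃ _ (-1756655 / 157738) <;> rw [ha, hb] <;> norm_num

/-- The point `t = (0, 0)` has order `12`: its multiple `6 t` has order `2` and differs
from `2 t`. -/
lemma addOrderOf_zero_zero (ha : a = 1024873209359 / 27734204981)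
    (hb : b = -543206429719981170 / 2187369012646489)
    (hO : (tateCurve a b).toAffine.Nonsingular 0 0) : addOrderOf (Point.some 0 0 hO) = 2 * 6 := by
  obtain ⟨⟨y, h, e₂⟩, e₆⟩ := nsmul_zero_zero ha hb hO
  have hT := addOrderOf_two_torsion ha hb
  refine addOrderOf_eq_of_nsmul_and_div_prime_nsmul (by norm_num) ?_ fun p hp hpd => ?_
  · rw [show 2 * 6 = 6 * 2 from rfl, mul_nsmul, e₆, ← hT]
    exact addOrderOf_nsmul_eq_zero _
  · obtain rfl | rfl : p = 2 ∨ p = 3 := by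
      have : p ∣ 2 ^ 2 * 3 := hpd
      rcases hp.dvd_mul.mp this with h2 | h3
      · exact .inl ((Nat.prime_dvd_prime_iff_eq hp Nat.prime_two).mp (hp.dvd_of_dvd_pow h2))
      · exact .inr ((Nat.prime_dvd_prime_iff_eq hp Nat.prime_three).mp h3)
    · rw [show 2 * 6 / 2 = 6 from rfl, e₆]
      exact Point.some_ne_zero _
    · intro h4
      rw [show 2 * 6 / 3 = 4 from rfl] at h4
      have h62 : 6 • Point.some 0 0 hO = 2 • Point.some 0 0 hO := by
        rw [show 6 = 4 + 2 from rfl, add_nsmul, h4, zero_add]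
      rw [e₂, e₆, Point.some.injEq, hb] at h62
      norm_num at h62

lemma addOrderOf_last (ha : a = 1024873209359 / 27734204981)
    (hb : b = -543206429719981170 / 2187369012646489) :
    addOrderOf (Point.some _ _ (nonsingular_ordinate ha hb (Fin.last 4))) = 2 * 6 := by
  have h := nonsingular_ordinate ha hb (Fin.last 4)
  have h0 : (num (Fin.last 4) / den (Fin.last 4) : ℚ) = 0 := by norm_num [num, den, Fin.last]
  have h0' : ordinate (Fin.last 4) = 0 := rfl
  rw [h0, h0'] at h
  convert addOrderOf_zero_zero ha hb h

lemma nsmul_eq_two_torsion (ha : a = 1024873209359 / 27734204981)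
    (hb : b = -543206429719981170 / 2187369012646489) :
    6 • Point.some _ _ (nonsingular_ordinate ha hb (Fin.last 4)) =
      Point.some _ _ (nonsingular_two_torsion ha hb) := by
  have h := nonsingular_ordinate ha hb (Fin.last 4)
  have h0 : (num (Fin.last 4) / den (Fin.last 4) : ℚ) = 0 := by norm_num [num, den, Fin.last]
  have h0' : ordinate (Fin.last 4) = 0 := rfl
  rw [h0, h0'] at h
  rw [← (nsmul_zero_zero ha hb h).2]
  congr 2

/-- Independence modulo `2` of the five points, seen from quadratic characters modulo `23` (two
of them), `41`, `43` and `53`. -/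
lemma eq_empty_of_sum_eq_two_smul (ha : a = 1024873209359 / 27734204981)
    (hb : b = -543206429719981170 / 2187369012646489)
    (S : Finset (Fin 5)) (Q : (tateCurve a b).toAffine.Point)
    (hQ : ∑ i ∈ S, Point.some _ _ (nonsingular_ordinate ha hb i) = (2 : ℤ) • Q) : S = ∅ := by
  -- `hXp` lists the residues modulo `p` of the abscissas.
  have : Fact (Nat.Prime 23) := ⟨by norm_num⟩
  have hd23 : ∀ i, ¬ ((23 : ℕ) : ℤ) ∣ den i := by decide
  have hr23 := reduces ha hb 23 10 1 (by norm_num) (by norm_num) (by norm_num)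
  have hX23 : ∀ i, PadicReduces (Rat.castHom ℚ_[23] (num i / den i)) (![22, 22, 21, 5, 0] i) :=
    fun i => .ratCast_of_eq_div _ _ _ rfl (hd23 i) (by revert i; decide)
  have : Fact (Nat.Prime 41) := ⟨by norm_num⟩
  have hd41 : ∀ i, ¬ ((41 : ℕ) : ℤ) ∣ den i := by decide
  have hr41 := reduces ha hb 41 9 29 (by norm_num) (by norm_num) (by norm_num)
  have hX41 : ∀ i, PadicReduces (Rat.castHom ℚ_[41] (num i / den i)) (![18, 18, 36, 32, 0] i) :=
    fun i => .ratCast_of_eq_div _ _ _ rfl (hd41 i) (by revert i; decide)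
  have : Fact (Nat.Prime 43) := ⟨by norm_num⟩
  have hd43 : ∀ i, ¬ ((43 : ℕ) : ℤ) ∣ den i := by decide
  have hr43 := reduces ha hb 43 31 27 (by norm_num) (by norm_num) (by norm_num)
  have hX43 : ∀ i, PadicReduces (Rat.castHom ℚ_[43] (num i / den i)) (![31, 16, 0, 10, 0] i) :=
    fun i => .ratCast_of_eq_div _ _ _ rfl (hd43 i) (by revert i; decide)
  have : Fact (Nat.Prime 53) := ⟨by norm_num⟩
  have hd53 : ∀ i, ¬ ((53 : ℕ) : ℤ) ∣ den i := by decide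
  have hr53 := reduces ha hb 53 49 31 (by norm_num) (by norm_num) (by norm_num)
  have hX53 : ∀ i, PadicReduces (Rat.castHom ℚ_[53] (num i / den i)) (![45, 0, 49, 20, 0] i) :=
    fun i => .ratCast_of_eq_div _ _ _ rfl (hd53 i) (by revert i; decide)
  have h23_4 := prod_eq_one_of_sum_eq_two_smul _ hr23.1 hr23.2 (by norm_num) (e := 4)
    (by norm_num) (by norm_num) (nonsingular_ordinate ha hb) hX23 (χ := ![1, 1, -1, 1, -1])
    (by intro i; fin_cases i <;> norm_num) (by decide) S Q hQ
  have h23_18 := prod_eq_one_of_sum_eq_two_smul _ hr23.1 hr23.2 (by norm_num) (e := 18)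
    (by norm_num) (by norm_num) (nonsingular_ordinate ha hb) hX23 (χ := ![1, 1, 1, -1, -1])
    (by intro i; fin_cases i <;> norm_num) (by decide) S Q hQ
  have h41_30 := prod_eq_one_of_sum_eq_two_smul _ hr41.1 hr41.2 (by norm_num) (e := 30)
    (by norm_num) (by norm_num) (nonsingular_ordinate ha hb) hX41 (χ := ![-1, -1, -1, 1, -1])
    (by intro i; fin_cases i <;> norm_num) (by decide) S Q hQ
  have h43_2 := prod_eq_one_of_sum_eq_two_smul _ hr43.1 hr43.2 (by norm_num) (e := 2)
    (by norm_num) (by norm_num) (nonsingular_ordinate ha hb) hX43 (χ := ![-1, 1, 1, -1, 1])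
    (by intro i; fin_cases i <;> norm_num) (by decide) S Q hQ
  have h53_15 := prod_eq_one_of_sum_eq_two_smul _ hr53.1 hr53.2 (by norm_num) (e := 15)
    (by norm_num) (by norm_num) (nonsingular_ordinate ha hb) hX53 (χ := ![-1, 1, -1, -1, 1])
    (by intro i; fin_cases i <;> norm_num) (by decide) S Q hQ
  clear hQ
  -- The five vectors of signs form a basis of `{±1}⁵`, so that only the empty product is trivial.
  revert S
  decide +kernel

theorem eq_zero_of_sum_zsmul_eq_zero (ha : a = 1024873209359 / 27734204981)
    (hb : b = -543206429719981170 / 2187369012646489)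
    (n : Fin 4 → ℤ)
    (hn : ∑ i, n i • Point.some _ _ (nonsingular_ordinate ha hb (Fin.castSucc i)) = 0) : n = 0 := by
  have : Fact (Nat.Prime 31) := ⟨by norm_num⟩
  refine eq_zero_of_sum_zsmul_castSucc_eq_zero
    (fun i => Point.some _ _ (nonsingular_ordinate ha hb i)) (fun Q hQ => ?_)
    (eq_empty_of_sum_eq_two_smul ha hb) n hn
  have hT := addOrderOf_two_torsion ha hb
  rcases eq_zero_or_eq_of_two_zsmul_eq_zero _ (reduces_mod_thirty_one ha hb).1
    (reduces_mod_thirty_one ha hb).2 (by norm_num) 14 (by decide) (by norm_num)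
    (T := Point.some _ _ (nonsingular_two_torsion ha hb))
    (by rw [← addOrderOf_dvd_iff_zsmul_eq_zero, hT]; norm_num) (Point.some_ne_zero _) hQ
    with rfl | rfl
  · exact ⟨0, (zero_zsmul _).symm⟩
  · exact ⟨6, (nsmul_eq_two_torsion ha hb).symm.trans (natCast_zsmul _ _).symm⟩

/-- The quadratic field enters only through the points of order `2`, which become rational over it;
the other points are rational over `ℚ`. -/
theorem mordellWeilContains_two_twelve {K : Type} [Field K] [CharZero K] {w : K}
    (hw : w ^ 2 = 2947271015) (hwq : ∀ q : ℚ, (q : K) ≠ w) :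
    (tateCurve (1024873209359 / 27734204981 : K)
        (-543206429719981170 / 2187369012646489)).IsElliptic ∧
      MordellWeilContains
        (tateCurve (1024873209359 / 27734204981 : K)
          (-543206429719981170 / 2187369012646489))
        (ZMod 2 × ZMod 12) 4 := by
  have ha : ((1024873209359 / 27734204981 : ℚ) : K) = 1024873209359 / 27734204981 := by norm_num
  have hb : ((-543206429719981170 / 2187369012646489 : ℚ) : K) =
      -543206429719981170 / 2187369012646489 := by norm_num
  have hE : (tateCurve (1024873209359 / 27734204981 : K)
      (-543206429719981170 / 2187369012646489)).IsElliptic := by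
    have := isElliptic rfl rfl
    rw [← map_eq (Rat.castHom K) ha hb]
    infer_instance
  refine ⟨hE, ?_⟩
  have h₂ : (tateCurve (1024873209359 / 27734204981 : K)
      (-543206429719981170 / 2187369012646489)).toAffine.Nonsingular
      ((-7087580040443760 * w - 363729070976387812410) / 5783354330286655717)
      ((3631935451319193664872574920 * w + 206304377019681182794367338165500) /
        160396734473924086144253526377) :=
    nonsingular (by
      linear_combination
        (3694927561847692246170795931364679897136675268649585600 /
            25727112429898507387549876425373142737802312716199834746129
          + 356036013240385617839955659567991163034789376000 /
            193436935563146672086841176130625133366934682076690486813 * w) * hw)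
  have hx₂ : ∀ q : ℚ, (q : K) ≠
      (-7087580040443760 * w - 363729070976387812410) / 5783354330286655717 := fun q hq =>
    hwq (-(5783354330286655717 * q + 363729070976387812410) / 7087580040443760)
      (by push_cast; rw [hq]; ring)
  obtain ⟨f, hf, -⟩ := mordellWeilContainsWith_of_rational ha hb 6 (addOrderOf_last rfl rfl) _
    (nsmul_eq_two_torsion rfl rfl) h₂ (by ring) hx₂
    (fun i => nonsingular_ordinate rfl rfl (Fin.castSucc i)) (eq_zero_of_sum_zsmul_eq_zero rfl rfl)
    (fun _ => rfl) (fun _ => rfl)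
  exact ⟨f, hf⟩

end TwoTwelve

end tateCurve

/-! ### The four quadratic fields -/

namespace QuadraticAlgebra

lemma ratCast_ne_omega {c₀ c₁ : ℚ} [Fact (∀ r : ℚ, r ^ 2 ≠ c₀ + c₁ * r)] (q : ℚ) :
    (q : QuadraticAlgebra ℚ c₀ c₁) ≠ omega := by
  intro h
  rw [← eq_ratCast (algebraMap ℚ (QuadraticAlgebra ℚ c₀ c₁)) q] at h
  simpa using congrArg im h

end QuadraticAlgebra

theorem theoremt6 :
    (∃ (K : Type) (_ : Field K) (_ : NumberField K) (w : K),
      IsQuadraticField K ∧ w ^ 2 - w - 86 = 0 ∧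
      (tateCurve ((10 * w + 493) / 448) ((10 * w + 45) / 448)).IsElliptic ∧
      MordellWeilContainsWith (tateCurve ((10 * w + 493) / 448) ((10 * w + 45) / 448))
        (ZMod 15)
        ![(-w - 274) / 3584]
        ![(-2455 * w - 20382) / 200704]) ∧
    (∃ (K : Type) (_ : Field K) (_ : NumberField K) (w : K),
      IsQuadraticField K ∧ w ^ 2 + 163 * w + 12 = 0 ∧
      (tateCurve ((25105 * w + 2071) / 216) ((634768555 * w + 46752805) / 7776)).IsElliptic ∧
      MordellWeilContainsWith
        (tateCurve ((25105 * w + 2071) / 216) ((634768555 * w + 46752805) / 7776))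
        (ZMod 18)
        ![(3673 * w + 223) / 486, (-112579 * w - 8293) / 6]
        ![(150110959 * w + 11056609) / 8748, (-3011095399 * w - 221775913) / 288]) ∧
    (∃ (K : Type) (_ : Field K) (_ : NumberField K) (w : K),
      IsQuadraticField K ∧ w ^ 2 = 55325286553 ∧
      (tateCurve (-1001929453 / 87419475 : K) (-1089348928 / 87419475)).IsElliptic ∧
      MordellWeilContainsWith
        (tateCurve (-1001929453 / 87419475 : K) (-1089348928 / 87419475))
        (ZMod 2 × ZMod 10)
        ![-76249664 / 9062625, 1378903694270734 / 47323818070815,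
          -317897024 / 55559933, -10158696384 / 631362875]
        ![-3294239461376 / 55961709375,
          -233856747339051186962702 / 6331823076742017702705,
          -54763043233792 / 3408435209751, -66880771114752 / 779733150625]) ∧
    (∃ (K : Type) (_ : Field K) (_ : NumberField K) (w : K),
      IsQuadraticField K ∧ w ^ 2 = 2947271015 ∧
      (tateCurve (1024873209359 / 27734204981 : K)
        (-543206429719981170 / 2187369012646489)).IsElliptic ∧
      MordellWeilContains
        (tateCurve (1024873209359 / 27734204981 : K)
          (-543206429719981170 / 2187369012646489))
        (ZMod 2 × ZMod 12) 4) := by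
  refine ⟨?_, ?_, ?_, ?_⟩
  -- The numbers `18`, `162`, `470426` and `108577` are the integer parts of the square roots of the
  -- discriminants.
  · have : Fact (∀ r : ℚ, r ^ 2 ≠ 86 + 1 * r) := ⟨fun r => by
      exact_mod_cast QuadraticAlgebra.sq_ne_of_disc_between (c₀ := 86) (c₁ := 1) 18 (by norm_num)
        (by norm_num) r⟩
    have hw : (QuadraticAlgebra.omega : QuadraticAlgebra ℚ 86 1) ^ 2 - QuadraticAlgebra.omega - 86
        = 0 := by
      rw [QuadraticAlgebra.omega_sq, map_one, map_ofNat]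
      ring
    exact ⟨QuadraticAlgebra ℚ 86 1, inferInstance, inferInstance, QuadraticAlgebra.omega,
      QuadraticAlgebra.isQuadraticField, hw, tateCurve.mordellWeilContainsWith_fifteen hw
        (fun _ => QuadraticAlgebra.exists_embedding (n₀ := 86) (n₁ := 1) (by norm_num)
          (by norm_num) 11 5 (by norm_num) (by norm_num))
        (fun _ => QuadraticAlgebra.exists_embedding (n₀ := 86) (n₁ := 1) (by norm_num)
          (by norm_num) 31 17 (by norm_num) (by norm_num))⟩
  · have : Fact (∀ r : ℚ, r ^ 2 ≠ -12 + -163 * r) := ⟨fun r => by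
      exact_mod_cast QuadraticAlgebra.sq_ne_of_disc_between (c₀ := -12) (c₁ := -163) 162
        (by norm_num) (by norm_num) r⟩
    have hw : (QuadraticAlgebra.omega : QuadraticAlgebra ℚ (-12) (-163)) ^ 2
        + 163 * QuadraticAlgebra.omega + 12 = 0 := by
      rw [QuadraticAlgebra.omega_sq, map_neg, map_neg, map_ofNat, map_ofNat]
      ring
    exact ⟨QuadraticAlgebra ℚ (-12) (-163), inferInstance, inferInstance, QuadraticAlgebra.omega,
      QuadraticAlgebra.isQuadraticField, hw, tateCurve.mordellWeilContainsWith_eighteen hw rfl rfl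
        (fun _ => QuadraticAlgebra.exists_embedding (n₀ := -12) (n₁ := -163) (by norm_num)
          (by norm_num) 13 9 (by norm_num) (by norm_num))
        (fun _ => QuadraticAlgebra.exists_embedding (n₀ := -12) (n₁ := -163) (by norm_num)
          (by norm_num) 19 2 (by norm_num) (by norm_num))
        (fun _ => QuadraticAlgebra.exists_embedding (n₀ := -12) (n₁ := -163) (by norm_num)
          (by norm_num) 71 45 (by norm_num) (by norm_num))⟩
  · have : Fact (∀ r : ℚ, r ^ 2 ≠ 55325286553 + 0 * r) := ⟨fun r => by
      exact_mod_cast QuadraticAlgebra.sq_ne_of_disc_between (c₀ := 55325286553) (c₁ := 0) 470426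
        (by norm_num) (by norm_num) r⟩
    have hw : (QuadraticAlgebra.omega : QuadraticAlgebra ℚ 55325286553 0) ^ 2 = 55325286553 := by
      rw [QuadraticAlgebra.omega_sq, map_zero, map_ofNat]
      ring
    exact ⟨QuadraticAlgebra ℚ 55325286553 0, inferInstance, inferInstance, QuadraticAlgebra.omega,
      QuadraticAlgebra.isQuadraticField, hw,
      tateCurve.TwoTen.mordellWeilContainsWith_two_ten hw QuadraticAlgebra.ratCast_ne_omega⟩
  · have : Fact (∀ r : ℚ, r ^ 2 ≠ 2947271015 + 0 * r) := ⟨fun r => by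
      exact_mod_cast QuadraticAlgebra.sq_ne_of_disc_between (c₀ := 2947271015) (c₁ := 0) 108577
        (by norm_num) (by norm_num) r⟩
    have hw : (QuadraticAlgebra.omega : QuadraticAlgebra ℚ 2947271015 0) ^ 2 = 2947271015 := by
      rw [QuadraticAlgebra.omega_sq, map_zero, map_ofNat]
      ring
    exact ⟨QuadraticAlgebra ℚ 2947271015 0, inferInstance, inferInstance, QuadraticAlgebra.omega,
      QuadraticAlgebra.isQuadraticField, hw,
      tateCurve.TwoTwelve.mordellWeilContains_two_twelve hw QuadraticAlgebra.ratCast_ne_omega⟩
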